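/- Let $N\ge 2$, let $B_1^c=\{x\in\mathbb{R}^N : |x|>1\}$, and let $K:B_1^c\to(0,\infty)$ be a continuous function for which there exist constants $C>0$ and $\gamma>N$ such that $K(x)\le C|x|^{-\gamma}$ for all $|x|>1$. Let $\mathcal D^{1,N}_0(B_1^c)$ be the Beppo-Levi space, i.e. the completion of the space $C_c^\infty(B_1^c)$ of smooth real functions with compact support in $B_1^c$ with respect to the norm $\|u\|=\left(\int_{B_1^c}|\nabla u|^N\,dx\right)^{1/N}$, and for $r\in[1,\infty)$ let $L^r(B_1^c;K)$ be the Lebesgue space with norm $\left(\int_{B_1^c}|u|^rK(x)\,dx\right)^{1/r}$. Then for every $r\in[1,\infty)$ the space $\mathcal D^{1,N}_0(B_1^c)$ is continuously and compactly embedded into $L^r(B_1^c;K)$; that is, the inclusion $C_c^\infty(B_1^c)\subset L^r(B_1^c;K)$ extends to an injective bounded linear map $\mathcal D^{1,N}_0(B_1^c)\to L^r(B_1^c;K)$, and this map is a compact operator. -/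

import Mathlib

open MeasureTheory TopologicalSpace
open scoped ENNReal Gradient

noncomputable section

/-- The exterior `{x ∈ ℝᴺ : |x| > 1}` of the closed unit ball, as an open set. -/
def unitBallExterior (N : ℕ) : Opens (EuclideanSpace ℝ (Fin N)) :=
  ⟨{x | 1 < ‖x‖}, isOpen_lt continuous_const continuous_norm⟩

/-- The vector space of smooth real functions with compact support inside the exterior of the unit
ball. It is a type synonym of Mathlib's test functions, so that it can carry the gradient norm
(instead of the LF topology). -/
def ExteriorTest (N : ℕ) : Type := TestFunction (unitBallExterior N) ℝ ⊤

namespace ExteriorTest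

variable {N : ℕ}

instance : AddCommGroup (ExteriorTest N) :=
  inferInstanceAs (AddCommGroup (TestFunction (unitBallExterior N) ℝ ⊤))

instance : Module ℝ (ExteriorTest N) :=
  inferInstanceAs (Module ℝ (TestFunction (unitBallExterior N) ℝ ⊤))

instance : FunLike (ExteriorTest N) (EuclideanSpace ℝ (Fin N)) ℝ :=
  inferInstanceAs (FunLike (TestFunction (unitBallExterior N) ℝ ⊤) _ _)

/-- The Dirichlet norm `(∫_{|x|>1} |∇φ|ᴺ dx)^{1/N}`. -/
instance : Norm (ExteriorTest N) :=
  ⟨fun φ => (∫ x in (unitBallExterior N : Set (EuclideanSpace ℝ (Fin N))),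
    ‖∇ φ x‖ ^ N) ^ (1 / (N : ℝ))⟩

theorem norm_eq (φ : ExteriorTest N) :
    ‖φ‖ = (∫ x in (unitBallExterior N : Set (EuclideanSpace ℝ (Fin N))),
      ‖∇ φ x‖ ^ N) ^ (1 / (N : ℝ)) := rfl

theorem contDiff (φ : ExteriorTest N) : ContDiff ℝ ((⊤ : ℕ∞) : WithTop ℕ∞) φ :=
  TestFunction.contDiff (Ω := unitBallExterior N) φ

theorem hasCompactSupport (φ : ExteriorTest N) : HasCompactSupport φ :=
  TestFunction.hasCompactSupport (Ω := unitBallExterior N) φ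

theorem tsupport_subset (φ : ExteriorTest N) :
    tsupport φ ⊆ (unitBallExterior N : Set (EuclideanSpace ℝ (Fin N))) :=
  TestFunction.tsupport_subset (Ω := unitBallExterior N) φ

theorem differentiable (φ : ExteriorTest N) : Differentiable ℝ φ :=
  φ.contDiff.differentiable (by simp)

theorem add_coe (φ ψ : ExteriorTest N) : ⇑(φ + ψ) = ⇑φ + ⇑ψ := rfl

theorem smul_coe (c : ℝ) (φ : ExteriorTest N) :
    ⇑(c • φ) = c • ⇑φ := rfl

theorem grad_eq (φ : ExteriorTest N) (x : EuclideanSpace ℝ (Fin N)) :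
    ∇ φ x = (InnerProductSpace.toDual ℝ _).symm (fderiv ℝ φ x) := rfl

theorem continuous_grad (φ : ExteriorTest N) : Continuous (∇ φ) :=
  (InnerProductSpace.toDual ℝ _).symm.continuous.comp
    (φ.contDiff.continuous_fderiv (by simp))

theorem hasCompactSupport_grad (φ : ExteriorTest N) : HasCompactSupport (∇ φ) :=
  (φ.hasCompactSupport.fderiv ℝ).comp_left
    (g := (InnerProductSpace.toDual ℝ _).symm) (map_zero _)

theorem memLp_grad (φ : ExteriorTest N) (p : ℝ≥0∞) :
    MemLp (∇ φ) p (volume.restrict (unitBallExterior N : Set (EuclideanSpace ℝ (Fin N)))) :=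
  (φ.continuous_grad.memLp_of_hasCompactSupport φ.hasCompactSupport_grad).restrict _

theorem grad_add (φ ψ : ExteriorTest N) : ∇ (φ + ψ : ExteriorTest N) = ∇ φ + ∇ ψ := by
  ext1 x
  rw [Pi.add_apply, grad_eq, grad_eq, grad_eq, add_coe, fderiv_add (φ.differentiable x) (ψ.differentiable x), map_add]

theorem grad_smul (c : ℝ) (φ : ExteriorTest N) : ∇ (c • φ : ExteriorTest N) = c • ∇ φ := by
  ext1 x
  rw [Pi.smul_apply, grad_eq, grad_eq, smul_coe, fderiv_const_smul (φ.differentiable x), map_smulₛₗ]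
  simp

theorem norm_eq_eLpNorm (hN : N ≠ 0) (φ : ExteriorTest N) :
    ‖φ‖ = (eLpNorm (∇ φ) N
      (volume.restrict (unitBallExterior N : Set (EuclideanSpace ℝ (Fin N))))).toReal := by
  rw [(φ.memLp_grad N).eLpNorm_eq_integral_rpow_norm (by simpa using hN) (by simp), norm_eq,
    ENNReal.toReal_ofReal (by positivity)]
  simp

theorem eq_zero_of_norm_eq_zero (hN : N ≠ 0) (φ : ExteriorTest N) (h : ‖φ‖ = 0) : φ = 0 := by
  rw [norm_eq_eLpNorm hN, ENNReal.toReal_eq_zero_iff] at h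
  have h0 := h.resolve_right (φ.memLp_grad N).eLpNorm_ne_top
  rw [eLpNorm_eq_zero_iff (φ.memLp_grad N).1 (by simpa using hN)] at h0
  have hopen : IsOpen (unitBallExterior N : Set (EuclideanSpace ℝ (Fin N))) :=
    (unitBallExterior N).isOpen
  have hon : Set.EqOn (∇ φ) 0 (unitBallExterior N : Set (EuclideanSpace ℝ (Fin N))) :=
    Measure.eqOn_open_of_ae_eq h0 hopen φ.continuous_grad.continuousOn continuousOn_const
  have hfd : ∀ x, fderiv ℝ φ x = 0 := by
    intro x
    by_cases hx : x ∈ (unitBallExterior N : Set (EuclideanSpace ℝ (Fin N)))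
    · simpa [grad_eq] using hon hx
    · exact image_eq_zero_of_notMem_tsupport
        fun hx' => hx (φ.tsupport_subset (tsupport_fderiv_subset ℝ hx'))
  have hz : φ 0 = 0 := by
    apply image_eq_zero_of_notMem_tsupport
    intro hx
    have : (1 : ℝ) < ‖(0 : EuclideanSpace ℝ (Fin N))‖ := φ.tsupport_subset hx
    norm_num at this
  refine DFunLike.ext _ _ fun x => ?_
  exact (is_const_of_fderiv_eq_zero φ.differentiable hfd x 0).trans hz

variable [Fact (2 ≤ N)]

theorem dim_ne_zero : N ≠ 0 := by
  have := Fact.out (p := 2 ≤ N)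
  lia

theorem normedSpaceCore : NormedSpace.Core ℝ (ExteriorTest N) where
  norm_nonneg φ := by rw [norm_eq]; positivity
  norm_smul c φ := by
    rw [norm_eq_eLpNorm dim_ne_zero, norm_eq_eLpNorm dim_ne_zero, grad_smul,
      eLpNorm_const_smul, ENNReal.toReal_mul]
    simp
  norm_triangle φ ψ := by
    have h1 : (1 : ℝ≥0∞) ≤ N := by
      exact_mod_cast Nat.one_le_iff_ne_zero.mpr dim_ne_zero
    simp only [norm_eq_eLpNorm dim_ne_zero, grad_add]
    rw [← ENNReal.toReal_add (φ.memLp_grad N).eLpNorm_ne_top (ψ.memLp_grad N).eLpNorm_ne_top]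
    exact ENNReal.toReal_mono
      (ENNReal.add_ne_top.mpr ⟨(φ.memLp_grad N).eLpNorm_ne_top, (ψ.memLp_grad N).eLpNorm_ne_top⟩)
      (eLpNorm_add_le (φ.memLp_grad N).1 (ψ.memLp_grad N).1 h1)
  norm_eq_zero_iff φ := by
    refine ⟨eq_zero_of_norm_eq_zero dim_ne_zero φ, ?_⟩
    rintro rfl
    have h : ∇ (0 : ExteriorTest N) = 0 := by
      have := grad_smul (0 : ℝ) (0 : ExteriorTest N)
      rwa [smul_zero, zero_smul] at this
    rw [norm_eq_eLpNorm dim_ne_zero, h]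
    simp

instance : NormedAddCommGroup (ExteriorTest N) := NormedAddCommGroup.ofCore normedSpaceCore

instance : NormedSpace ℝ (ExteriorTest N) := NormedSpace.ofCore normedSpaceCore

end ExteriorTest

/-- The Beppo-Levi space `D₀^{1,N}` of the exterior of the unit ball: the completion of the
compactly supported smooth functions with respect to `(∫ |∇φ|ᴺ)^{1/N}`. -/
abbrev BeppoLevi (N : ℕ) [Fact (2 ≤ N)] : Type := UniformSpace.Completion (ExteriorTest N)

/-- The measure `K(x) dx` on the exterior of the unit ball. -/
def weightedMeasure (N : ℕ) (K : EuclideanSpace ℝ (Fin N) → ℝ) :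
    Measure (EuclideanSpace ℝ (Fin N)) :=
  (volume.restrict (unitBallExterior N : Set (EuclideanSpace ℝ (Fin N)))).withDensity
    fun x => ENNReal.ofReal (K x)

end

/-! Let p = N/(N-1) and let c satisfy cp > N. The Sobolev inequality from W^{1,1} into L^p, applied
to φ^{s+1}|x|^{-c}, produces two gradient terms. The one in which the weight is differentiated is
absorbed by an L¹ Hardy inequality, because c + 1 > N. Hölder's inequality with exponents p and N
bounds the other by ‖φ^s|x|^{-c}‖_p ‖∇φ‖_N. Induction on s, starting from |x|^{-c} ∈ L^p(|x| > 1),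
gives ‖φ^s|x|^{-c}‖_p ≤ C‖φ‖^s. With c = γ/p the p-th power of the weight is |x|^{-γ}, which
dominates K up to a constant. This bounds φ in L^{sp}(K) for every s, hence in every L^r(K) with r
finite, since K dx is a finite measure.

Compactness reduces to showing that finitely many continuous functionals control the norm of Tφ on
bounded sets. Integrals of φ over small balls do this in L¹ on bounded sets, by the translation
estimate ‖φ(· + h) - φ‖ ≤ C|h|‖φ‖. Tails are small by finiteness of K dx and the L²(K) bound, and
Cauchy–Schwarz between L¹(K) and L^{2r-1}(K) reaches L^r(K).

Injectivity is closability of the gradient. The gradient extends to an isometry G into L^N, and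
integration by parts bounds ∫ g Gu by the L^r(K) norm of the image of u, since K is bounded below on
the compact support of g. If the image of u vanishes, so does Gu, and then u. -/

open scoped NNReal

/-! ### Estimates from integrating the derivative along segments -/

section SegmentEstimates

variable {E F : Type*} [NormedAddCommGroup E] [NormedSpace ℝ E]
  [NormedAddCommGroup F] [NormedSpace ℝ F]

theorem enorm_sub_le_lintegral_fderiv_segment {f : E → F} (hf : ContDiff ℝ 1 f) (x h : E) :
    ‖f (x + h) - f x‖ₑ ≤ ∫⁻ t in Set.Ioc (0 : ℝ) 1, ‖h‖ₑ * ‖fderiv ℝ f (x + t • h)‖ₑ := by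
  have hd : ∀ t : ℝ, HasDerivAt (fun t : ℝ => f (x + t • h)) (fderiv ℝ f (x + t • h) h) t := by
    intro t
    have h1 : HasDerivAt (fun t : ℝ => x + t • h) h t := by
      simpa using ((hasDerivAt_id t).smul_const h).const_add x
    exact (hf.differentiable (by simp) _).hasFDerivAt.comp_hasDerivAt t h1
  have hc : ContDiff ℝ 1 (fun t : ℝ => f (x + t • h)) := by fun_prop
  have := enorm_sub_le_lintegral_deriv_of_contDiffOn_Icc hc.contDiffOn (zero_le_one (α := ℝ))
  simp only [one_smul, zero_smul, add_zero] at this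
  refine this.trans ?_
  rw [← restrict_Ioc_eq_restrict_Icc]
  refine lintegral_mono fun t => ?_
  rw [(hd t).deriv, mul_comm]
  exact ContinuousLinearMap.le_opENorm _ _

variable [MeasurableSpace E] [BorelSpace E] [FiniteDimensional ℝ E]
  (μ : Measure E) [μ.IsAddHaarMeasure]

/-- Integrate the segment bound over x and apply Tonelli: for each t in (0, 1] the translate of the
R-ball by th stays in the ball of radius R + ‖h‖. -/
theorem setLIntegral_ball_enorm_add_sub_le {f : E → F} (hf : ContDiff ℝ 1 f) (R : ℝ) (h : E) :
    ∫⁻ x in Metric.ball 0 R, ‖f (x + h) - f x‖ₑ ∂μ ≤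
      ‖h‖ₑ * ∫⁻ x in Metric.ball 0 (R + ‖h‖), ‖fderiv ℝ f x‖ₑ ∂μ := by
  have hcont : Continuous (fun x => ‖fderiv ℝ f x‖ₑ) :=
    (hf.continuous_fderiv (by simp)).enorm
  calc ∫⁻ x in Metric.ball 0 R, ‖f (x + h) - f x‖ₑ ∂μ
      ≤ ∫⁻ x in Metric.ball 0 R, (∫⁻ t in Set.Ioc (0 : ℝ) 1,
          ‖h‖ₑ * ‖fderiv ℝ f (x + t • h)‖ₑ) ∂μ :=
        lintegral_mono fun x => enorm_sub_le_lintegral_fderiv_segment hf x h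
    _ = ∫⁻ t in Set.Ioc (0 : ℝ) 1, ∫⁻ x in Metric.ball 0 R,
          ‖h‖ₑ * ‖fderiv ℝ f (x + t • h)‖ₑ ∂μ := by
        rw [lintegral_lintegral_swap]
        refine Measurable.aemeasurable (Measurable.const_mul ?_ _)
        exact (hcont.comp (by fun_prop : Continuous fun p : E × ℝ => p.1 + p.2 • h)).measurable
    _ ≤ ∫⁻ t in Set.Ioc (0 : ℝ) 1,
          ‖h‖ₑ * ∫⁻ x in Metric.ball 0 (R + ‖h‖), ‖fderiv ℝ f x‖ₑ ∂μ := by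
        refine setLIntegral_mono' measurableSet_Ioc fun t ht => ?_
        have hm : Measurable fun x => ‖fderiv ℝ f (x + t • h)‖ₑ :=
          (hcont.comp (by fun_prop : Continuous fun x : E => x + t • h)).measurable
        rw [lintegral_const_mul _ hm]
        refine mul_le_mul_right ?_ _
        rw [← lintegral_indicator Metric.isOpen_ball.measurableSet,
          ← lintegral_indicator Metric.isOpen_ball.measurableSet,
          ← lintegral_add_right_eq_self
            ((Metric.ball 0 (R + ‖h‖)).indicator fun x => ‖fderiv ℝ f x‖ₑ) (t • h)]
        refine lintegral_mono fun x => ?_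
        by_cases hx : x ∈ Metric.ball 0 R
        · have : x + t • h ∈ Metric.ball 0 (R + ‖h‖) := by
            simp only [mem_ball_zero_iff] at hx ⊢
            have h1 : ‖t • h‖ ≤ ‖h‖ := by
              rw [norm_smul, Real.norm_of_nonneg ht.1.le]
              exact mul_le_of_le_one_left (norm_nonneg _) ht.2
            linarith [norm_add_le x (t • h)]
          simp [hx, this]
        · simp [hx]
    _ = _ := by simp

theorem lintegral_comp_smul_of_pos {g : E → ℝ≥0∞} (hg : Measurable g) {t : ℝ} (ht : 0 < t) :
    ∫⁻ x, g (t • x) ∂μ =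
      ENNReal.ofReal (t ^ (-(Module.finrank ℝ E : ℝ))) * ∫⁻ x, g x ∂μ := by
  rw [← lintegral_map hg (by fun_prop), Measure.map_addHaar_smul μ ht.ne', lintegral_smul_measure,
    abs_of_pos (by positivity), Real.rpow_neg ht.le, Real.rpow_natCast, smul_eq_mul]

/-- An L¹ Hardy inequality. Along the ray from 0 to x the factor ‖x‖ · ‖x‖^{-(c+1)} equals t^c
‖tx‖^{-c}. Rescaling tx to x costs t^{-d}, and the integral of t^{c-d} over (0, 1] is the constant,
finite exactly because d < c + 1. -/
theorem lintegral_enorm_mul_norm_rpow_neg_le {f : E → F} (hf : ContDiff ℝ 1 f) (h0 : f 0 = 0)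
    {c : ℝ} (hc : (Module.finrank ℝ E : ℝ) < c + 1) :
    ∫⁻ x, ‖f x‖ₑ * ‖‖x‖ ^ (-(c + 1))‖ₑ ∂μ ≤
      ENNReal.ofReal (1 / (c + 1 - Module.finrank ℝ E)) *
        ∫⁻ x, ‖fderiv ℝ f x‖ₑ * ‖‖x‖ ^ (-c)‖ₑ ∂μ := by
  set d := (Module.finrank ℝ E : ℝ)
  have hcont : Continuous (fun x => ‖fderiv ℝ f x‖ₑ) :=
    (hf.continuous_fderiv (by simp)).enorm
  have hg : Measurable fun x : E => ‖fderiv ℝ f x‖ₑ * ‖‖x‖ ^ (-c)‖ₑ :=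
    hcont.measurable.mul (by fun_prop)
  have hpt : ∀ x : E, ‖f x‖ₑ * ‖‖x‖ ^ (-(c + 1))‖ₑ ≤
      ∫⁻ t in Set.Ioc (0 : ℝ) 1, ENNReal.ofReal (t ^ c) *
        (‖fderiv ℝ f (t • x)‖ₑ * ‖‖t • x‖ ^ (-c)‖ₑ) := by
    intro x
    rcases eq_or_ne x 0 with rfl | hx
    · simp [h0]
    have h1 := enorm_sub_le_lintegral_fderiv_segment hf 0 x
    simp only [zero_add, h0, sub_zero] at h1
    refine (mul_le_mul_left h1 _).trans ?_
    rw [← lintegral_mul_const]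
    · refine setLIntegral_mono' measurableSet_Ioc fun t ht => le_of_eq ?_
      have hxp : 0 < ‖x‖ := norm_pos_iff.2 hx
      have e1 : ‖x‖ₑ * ‖‖x‖ ^ (-(c + 1))‖ₑ = ENNReal.ofReal (t ^ c) * ‖‖t • x‖ ^ (-c)‖ₑ := by
        rw [← ofReal_norm, Real.enorm_of_nonneg (by positivity),
          Real.enorm_of_nonneg (by positivity), ← ENNReal.ofReal_mul (by positivity),
          ← ENNReal.ofReal_mul (Real.rpow_nonneg ht.1.le _), norm_smul,
          Real.norm_of_nonneg ht.1.le, Real.mul_rpow ht.1.le hxp.le, ← mul_assoc,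
          ← Real.rpow_add ht.1, add_neg_cancel, Real.rpow_zero, one_mul]
        congr 1
        nth_rw 1 [← Real.rpow_one ‖x‖]
        rw [← Real.rpow_add hxp]
        congr 1
        ring
      rw [mul_right_comm, e1]
      ring
    · exact Measurable.const_mul
        (hcont.comp (by fun_prop : Continuous fun t : ℝ => t • x)).measurable _
  calc ∫⁻ x, ‖f x‖ₑ * ‖‖x‖ ^ (-(c + 1))‖ₑ ∂μ
      ≤ ∫⁻ x, (∫⁻ t in Set.Ioc (0 : ℝ) 1, ENNReal.ofReal (t ^ c) *
        (‖fderiv ℝ f (t • x)‖ₑ * ‖‖t • x‖ ^ (-c)‖ₑ)) ∂μ := lintegral_mono hpt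
    _ = ∫⁻ t in Set.Ioc (0 : ℝ) 1, ∫⁻ x, ENNReal.ofReal (t ^ c) *
        (‖fderiv ℝ f (t • x)‖ₑ * ‖‖t • x‖ ^ (-c)‖ₑ) ∂μ := by
        rw [lintegral_lintegral_swap]
        have h1 : Measurable fun p : E × ℝ => ENNReal.ofReal (p.2 ^ c) := by fun_prop
        exact (h1.mul (hg.comp (by fun_prop : Measurable fun p : E × ℝ => p.2 • p.1))).aemeasurable
    _ = ∫⁻ t in Set.Ioc (0 : ℝ) 1, ENNReal.ofReal (t ^ (c - d)) *
        ∫⁻ x, ‖fderiv ℝ f x‖ₑ * ‖‖x‖ ^ (-c)‖ₑ ∂μ := by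
        refine setLIntegral_congr_fun measurableSet_Ioc fun t ht => ?_
        have hg' : Measurable fun x : E => ‖fderiv ℝ f (t • x)‖ₑ * ‖‖t • x‖ ^ (-c)‖ₑ :=
          hg.comp (by fun_prop : Measurable fun x : E => t • x)
        rw [lintegral_const_mul _ hg', lintegral_comp_smul_of_pos μ hg ht.1, ← mul_assoc,
          ← ENNReal.ofReal_mul (Real.rpow_nonneg ht.1.le _), ← Real.rpow_add ht.1, sub_eq_add_neg]
    _ = _ := by
        rw [lintegral_mul_const _ (by fun_prop)]
        congr 1
        have hint : IntegrableOn (fun t : ℝ => t ^ (c - d)) (Set.Ioc 0 1) :=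
          (intervalIntegrable_iff_integrableOn_Ioc_of_le zero_le_one).1
            (intervalIntegral.intervalIntegrable_rpow' (by linarith))
        rw [← ofReal_integral_eq_lintegral_ofReal hint
          ((ae_restrict_mem measurableSet_Ioc).mono fun t ht => Real.rpow_nonneg ht.1.le _),
          ← intervalIntegral.integral_of_le zero_le_one, integral_rpow (Or.inl (by linarith)),
          Real.one_rpow, Real.zero_rpow (by linarith), sub_zero]
        congr 2
        ring

end SegmentEstimates

/-! ### Weighted Sobolev iteration -/

namespace ExteriorTest

variable {N : ℕ}

theorem ne_zero_of_mem_exterior {x : EuclideanSpace ℝ (Fin N)}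
    (hx : x ∈ (unitBallExterior N : Set (EuclideanSpace ℝ (Fin N)))) : x ≠ 0 := by
  rintro rfl
  have : (1 : ℝ) < ‖(0 : EuclideanSpace ℝ (Fin N))‖ := hx
  norm_num at this

theorem measurableSet_exterior :
    MeasurableSet (unitBallExterior N : Set (EuclideanSpace ℝ (Fin N))) :=
  (unitBallExterior N).isOpen.measurableSet

theorem eventuallyEq_zero (φ : ExteriorTest N) {x : EuclideanSpace ℝ (Fin N)}
    (hx : x ∉ (unitBallExterior N : Set (EuclideanSpace ℝ (Fin N)))) : φ =ᶠ[nhds x] 0 :=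
  notMem_tsupport_iff_eventuallyEq.1 fun h => hx (φ.tsupport_subset h)

theorem grad_eq_zero (φ : ExteriorTest N) {x : EuclideanSpace ℝ (Fin N)}
    (hx : x ∉ (unitBallExterior N : Set (EuclideanSpace ℝ (Fin N)))) : ∇ φ x = 0 := by
  rw [grad_eq, (φ.eventuallyEq_zero hx).fderiv_eq]
  simp

theorem enorm_grad (φ : ExteriorTest N) (x : EuclideanSpace ℝ (Fin N)) :
    ‖∇ φ x‖ₑ = ‖fderiv ℝ φ x‖ₑ := by
  rw [grad_eq, ← ofReal_norm, LinearIsometryEquiv.norm_map, ofReal_norm]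

theorem enorm_eq_eLpNorm [Fact (2 ≤ N)] (φ : ExteriorTest N) :
    ‖φ‖ₑ = eLpNorm (∇ φ) N
      (volume.restrict (unitBallExterior N : Set (EuclideanSpace ℝ (Fin N)))) := by
  rw [← ofReal_norm, norm_eq_eLpNorm dim_ne_zero,
    ENNReal.ofReal_toReal (φ.memLp_grad N).eLpNorm_ne_top]

/-- The singularity of the weight at the origin is harmless: φ vanishes near every point outside the
exterior domain. -/
theorem contDiff_pow_mul_norm_rpow (φ : ExteriorTest N) (s : ℕ) (c : ℝ) :
    ContDiff ℝ 1 fun x => φ x ^ (s + 1) * ‖x‖ ^ (-c) := by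
  refine contDiff_iff_contDiffAt.2 fun x => ?_
  by_cases hx : x ∈ (unitBallExterior N : Set (EuclideanSpace ℝ (Fin N)))
  · have hx0 := ne_zero_of_mem_exterior hx
    exact ((φ.contDiff.of_le (by simp)).contDiffAt.pow _).mul
      ((contDiffAt_norm ℝ hx0).rpow_const_of_ne (norm_ne_zero_iff.2 hx0))
  · refine (contDiffAt_const (c := (0 : ℝ))).congr_of_eventuallyEq ?_
    filter_upwards [φ.eventuallyEq_zero hx] with y hy
    simp [hy]

theorem hasCompactSupport_pow_mul_norm_rpow (φ : ExteriorTest N) (s : ℕ) (c : ℝ) :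
    HasCompactSupport fun x => φ x ^ (s + 1) * ‖x‖ ^ (-c) :=
  (φ.hasCompactSupport.comp_left (g := fun y => y ^ (s + 1)) (by simp)).mul_right

theorem enorm_fderiv_pow (φ : ExteriorTest N) (s : ℕ) (x : EuclideanSpace ℝ (Fin N)) :
    ‖fderiv ℝ (fun x => φ x ^ (s + 1)) x‖ₑ = (s + 1 : ℕ) * (‖φ x ^ s‖ₑ * ‖∇ φ x‖ₑ) := by
  rw [((φ.differentiable x).hasFDerivAt.pow (s + 1)).fderiv, enorm_smul, enorm_grad,
    nsmul_eq_mul, enorm_mul, mul_assoc, add_tsub_cancel_right]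
  congr 1
  rw [Real.enorm_natCast]

theorem enorm_fderiv_pow_mul_norm_rpow_le (φ : ExteriorTest N) (s : ℕ) {c : ℝ} (hc : 0 ≤ c)
    (x : EuclideanSpace ℝ (Fin N)) :
    ‖fderiv ℝ (fun x => φ x ^ (s + 1) * ‖x‖ ^ (-c)) x‖ₑ ≤
      ‖fderiv ℝ (fun x => φ x ^ (s + 1)) x‖ₑ * ‖‖x‖ ^ (-c)‖ₑ +
        ENNReal.ofReal c * (‖φ x ^ (s + 1)‖ₑ * ‖‖x‖ ^ (-(c + 1))‖ₑ) := by
  by_cases hx : x ∈ (unitBallExterior N : Set (EuclideanSpace ℝ (Fin N)))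
  · have hx0 := ne_zero_of_mem_exterior hx
    have hn : DifferentiableAt ℝ (fun x : EuclideanSpace ℝ (Fin N) => ‖x‖) x :=
      (contDiffAt_norm ℝ hx0).differentiableAt (n := 1) (by simp)
    have h1 := hn.hasFDerivAt.rpow_const (p := -c) (Or.inl (norm_ne_zero_iff.2 hx0))
    have h2 : DifferentiableAt ℝ (fun x => φ x ^ (s + 1)) x := (φ.differentiable x).pow _
    have h3 : HasFDerivAt (fun x => φ x ^ (s + 1) * ‖x‖ ^ (-c)) _ x := h2.hasFDerivAt.mul h1
    rw [h3.fderiv, add_comm]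
    refine (enorm_add_le (E := EuclideanSpace ℝ (Fin N) →L[ℝ] ℝ) _ _).trans (add_le_add ?_ ?_)
    · rw [enorm_smul, mul_comm]
    · have h3 : ‖fderiv ℝ (fun x : EuclideanSpace ℝ (Fin N) => ‖x‖) x‖ₑ ≤ 1 := by
        rw [← ofReal_norm, ← ENNReal.ofReal_one]
        exact ENNReal.ofReal_le_ofReal (by
          simpa using norm_fderiv_le_of_lipschitz ℝ (x₀ := x)
            (lipschitzWith_one_norm (E := EuclideanSpace ℝ (Fin N))))
      rw [enorm_smul, enorm_smul, enorm_mul, enorm_neg, Real.enorm_of_nonneg hc,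
        show -c - 1 = -(c + 1) by ring, mul_left_comm, mul_assoc]
      refine mul_le_mul_right ?_ _
      rw [← mul_assoc, mul_comm ‖‖x‖ ^ (-(c + 1))‖ₑ]
      exact mul_le_of_le_one_right' h3
  · have : (fun x => φ x ^ (s + 1) * ‖x‖ ^ (-c)) =ᶠ[nhds x] fun _ => 0 := by
      filter_upwards [φ.eventuallyEq_zero hx] with y hy
      simp [hy]
    rw [this.fderiv_eq, fderiv_fun_const, Pi.zero_apply, ← ofReal_norm,
      norm_zero, ENNReal.ofReal_zero]
    exact zero_le

variable [Fact (2 ≤ N)]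

/-- One step of the iteration: a weighted Sobolev inequality which raises the power of `φ`
while keeping the weight. -/
theorem exists_eLpNorm_pow_succ_mul_norm_rpow_le {p : ℝ≥0}
    (hp : NNReal.HolderConjugate N p) {c : ℝ} (hc : (N : ℝ) < c + 1) (s : ℕ) :
    ∃ C : ℝ≥0, ∀ φ : ExteriorTest N,
      eLpNorm (fun x => φ x ^ (s + 1) * ‖x‖ ^ (-c)) p
          (volume.restrict (unitBallExterior N : Set (EuclideanSpace ℝ (Fin N)))) ≤
        C * (eLpNorm (fun x => φ x ^ s * ‖x‖ ^ (-c)) p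
          (volume.restrict (unitBallExterior N : Set (EuclideanSpace ℝ (Fin N)))) * ‖φ‖ₑ) := by
  have hN : 2 ≤ N := Fact.out
  have hc0 : 0 ≤ c := by
    have : (2 : ℝ) ≤ N := by exact_mod_cast hN
    linarith
  have hfin : Module.finrank ℝ (EuclideanSpace ℝ (Fin N)) = N := by simp
  set U : Set (EuclideanSpace ℝ (Fin N)) := ↑(unitBallExterior N)
  set S := eLpNormLESNormFDerivOneConst (volume : Measure (EuclideanSpace ℝ (Fin N))) p
  have hp' : ENNReal.HolderConjugate (p : ℝ≥0∞) (N : ℝ≥0∞) := by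
    simpa using hp.symm.coe_ennreal
  refine ⟨S * ((1 + c.toNNReal * (1 / (c + 1 - N)).toNNReal) * (s + 1 : ℕ)), fun φ => ?_⟩
  set A := ∫⁻ x, ‖fderiv ℝ (fun x => φ x ^ (s + 1)) x‖ₑ * ‖‖x‖ ^ (-c)‖ₑ with hA
  have hcd : ContDiff ℝ 1 (fun x => φ x ^ (s + 1)) := (φ.contDiff.of_le (by simp)).pow _
  have hmeas : Measurable fun x => ‖fderiv ℝ (fun x => φ x ^ (s + 1)) x‖ₑ * ‖‖x‖ ^ (-c)‖ₑ :=
    (hcd.continuous_fderiv (by simp)).enorm.measurable.mul (by fun_prop)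
  have hmeas2 : Measurable fun x => ‖φ x ^ (s + 1)‖ₑ * ‖‖x‖ ^ (-(c + 1))‖ₑ :=
    hcd.continuous.enorm.measurable.mul (by fun_prop)
  have hHardy := lintegral_enorm_mul_norm_rpow_neg_le volume hcd
    (by simp [(φ.eventuallyEq_zero (x := 0) fun h => ne_zero_of_mem_exterior h rfl).self_of_nhds])
    (c := c) (by rwa [hfin])
  rw [hfin] at hHardy
  have hSob : eLpNorm (fun x => φ x ^ (s + 1) * ‖x‖ ^ (-c)) p (volume.restrict U) ≤
      S * ((1 + ENNReal.ofReal c * ENNReal.ofReal (1 / (c + 1 - N))) * A) := by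
    refine (eLpNorm_mono_measure _ Measure.restrict_le_self).trans ?_
    -- Sobolev's inequality from W^{1,1} into L^p on all of ℝᴺ. The product rule then gives `A` plus
    -- c times the left side of `hHardy`, hence a multiple of `A`.
    refine (eLpNorm_le_eLpNorm_fderiv_one volume (φ.contDiff_pow_mul_norm_rpow s c)
      (φ.hasCompactSupport_pow_mul_norm_rpow s c) (by rwa [hfin])).trans ?_
    refine mul_le_mul_right ?_ _
    rw [eLpNorm_one_eq_lintegral_enorm]
    refine (lintegral_mono fun x => φ.enorm_fderiv_pow_mul_norm_rpow_le s hc0 x).trans ?_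
    rw [lintegral_add_left hmeas, lintegral_const_mul _ hmeas2, add_mul, one_mul, mul_assoc]
    gcongr
  -- Hölder's inequality with exponents p and N; the integral restricts to the exterior because ∇φ
  -- vanishes elsewhere.
  have hAle : A ≤ (s + 1 : ℕ) *
      (eLpNorm (fun x => φ x ^ s * ‖x‖ ^ (-c)) p (volume.restrict U) * ‖φ‖ₑ) := by
    have h1 : A = ∫⁻ x in U, (s + 1 : ℕ) * ‖(φ x ^ s * ‖x‖ ^ (-c)) • ∇ φ x‖ₑ := by
      rw [hA, ← lintegral_indicator measurableSet_exterior]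
      refine lintegral_congr fun x => ?_
      by_cases hx : x ∈ U
      · rw [Set.indicator_of_mem hx, enorm_fderiv_pow, enorm_smul, enorm_mul]
        ring
      · rw [Set.indicator_of_notMem hx, enorm_fderiv_pow, φ.grad_eq_zero hx]
        simp
    have hm1 : Measurable fun x => φ x ^ s * ‖x‖ ^ (-c) :=
      (φ.contDiff.continuous.pow s).measurable.mul (by fun_prop)
    have hm2 : Measurable (∇ φ) := φ.continuous_grad.measurable
    have hm3 : Measurable fun x => ‖(φ x ^ s * ‖x‖ ^ (-c)) • ∇ φ x‖ₑ := (hm1.smul hm2).enorm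
    rw [h1, lintegral_const_mul _ hm3, enorm_eq_eLpNorm]
    refine mul_le_mul_right ?_ _
    have := eLpNorm_smul_le_mul_eLpNorm (μ := volume.restrict U) (r := 1)
      hm2.aestronglyMeasurable hm1.aestronglyMeasurable (hpqr := hp')
    rwa [eLpNorm_one_eq_lintegral_enorm] at this
  refine hSob.trans ?_
  push_cast
  rw [mul_assoc, mul_assoc]
  refine mul_le_mul_right (mul_le_mul_right ?_ _) _
  exact_mod_cast hAle

/-- Powers of test functions are controlled in the weighted Lebesgue norm. -/
theorem exists_eLpNorm_pow_mul_norm_rpow_le {p : ℝ≥0}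
    (hp : NNReal.HolderConjugate N p) {c : ℝ} (hc : (N : ℝ) < c * p) (s : ℕ) :
    ∃ C : ℝ≥0, ∀ φ : ExteriorTest N,
      eLpNorm (fun x => φ x ^ s * ‖x‖ ^ (-c)) p
          (volume.restrict (unitBallExterior N : Set (EuclideanSpace ℝ (Fin N)))) ≤
        C * ‖φ‖ₑ ^ s := by
  have hp0 : 0 < (p : ℝ) := hp.coe.symm.pos
  have hN0 : 0 < (N : ℝ) := by simpa using hp.coe.pos
  have hc0 : 0 < c := pos_of_mul_pos_left (hN0.trans hc) hp0.le
  induction s with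
  | zero =>
    -- For |x| > 1 one has 1 + |x| ≤ 2|x|, so |x|^{-cp} ≤ 2^{cp}(1 + |x|)^{-cp}, which is integrable
    -- since cp > N.
    have hfinite : eLpNorm (fun x : EuclideanSpace ℝ (Fin N) => ‖x‖ ^ (-c)) p
        (volume.restrict (unitBallExterior N : Set (EuclideanSpace ℝ (Fin N)))) < ∞ := by
      rw [eLpNorm_lt_top_iff_lintegral_rpow_enorm_lt_top (by simpa using hp0.ne') (by simp)]
      have hint : Integrable (fun x : EuclideanSpace ℝ (Fin N) => (1 + ‖x‖) ^ (-(c * p))) :=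
        integrable_one_add_norm (by simpa using hc)
      refine lt_of_le_of_lt ?_ (ENNReal.mul_lt_top (ENNReal.ofReal_lt_top (r := 2 ^ (c * p)))
        hint.hasFiniteIntegral)
      rw [← lintegral_const_mul _ (by fun_prop)]
      refine (setLIntegral_mono' measurableSet_exterior fun x hx => ?_).trans
        (setLIntegral_le_lintegral _ _)
      have hx1 : 1 < ‖x‖ := hx
      rw [Real.enorm_of_nonneg (by positivity), Real.enorm_of_nonneg (by positivity),
        ENNReal.ofReal_rpow_of_nonneg (by positivity) (by simp),
        ← ENNReal.ofReal_mul (by positivity)]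
      refine ENNReal.ofReal_le_ofReal ?_
      dsimp only
      rw [ENNReal.coe_toReal, ← Real.rpow_mul (by positivity), Real.rpow_neg (by positivity),
        ← div_eq_mul_inv, ← Real.div_rpow (by positivity) (by positivity), neg_mul,
        Real.rpow_neg (by positivity), ← Real.inv_rpow (by positivity)]
      refine Real.rpow_le_rpow (by positivity) ?_ (by positivity)
      rw [inv_le_iff_one_le_mul₀ (by positivity), ← mul_div_right_comm, le_div_iff₀ (by positivity)]
      linarith
    exact ⟨_, fun φ => by simpa using (ENNReal.coe_toNNReal hfinite.ne).ge⟩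
  | succ s ih =>
    obtain ⟨C₁, hC₁⟩ := ih
    -- Conjugacy gives N = p(N - 1), so cp > N means c > N - 1: the Hardy condition is automatic.
    have hc1 : (N : ℝ) < c + 1 := by
      have h2 : (N : ℝ) = p * (N - 1) := by
        have := hp.coe.mul_eq_add
        simp at this
        linarith
      have h3 : (N : ℝ) - 1 < c := by
        by_contra! h
        nlinarith
      linarith
    obtain ⟨C₂, hC₂⟩ := exists_eLpNorm_pow_succ_mul_norm_rpow_le hp hc1 s
    refine ⟨C₂ * C₁, fun φ => (hC₂ φ).trans ?_⟩
    rw [ENNReal.coe_mul, pow_succ, mul_assoc, ← mul_assoc (C₁ : ℝ≥0∞)]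
    gcongr
    exact hC₁ φ

end ExteriorTest

/-! ### Boundedness into the weighted Lebesgue spaces -/

section Weighted

variable {N : ℕ} {K : EuclideanSpace ℝ (Fin N) → ℝ}

/-- Writing |x|^{-γ} as the p-th power of |x|^{-c} lets integrals against K dx be read as p-th
powers of the weighted norms of the iteration. -/
theorem lintegral_weightedMeasure_le {C γ c : ℝ} {p : ℝ≥0} (hC : 0 ≤ C) (hcp : c * p = γ)
    (hK : ∀ x, 1 < ‖x‖ → K x ≤ C / ‖x‖ ^ γ) {g : EuclideanSpace ℝ (Fin N) → ℝ≥0∞}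
    (hg : Measurable g) :
    ∫⁻ x, g x ∂weightedMeasure N K ≤ ENNReal.ofReal C *
      ∫⁻ x in (unitBallExterior N : Set (EuclideanSpace ℝ (Fin N))),
        ‖‖x‖ ^ (-c)‖ₑ ^ (p : ℝ) * g x := by
  have hm : Measurable fun x : EuclideanSpace ℝ (Fin N) =>
      ENNReal.ofReal C * ‖‖x‖ ^ (-c)‖ₑ ^ (p : ℝ) := by fun_prop
  have hle : weightedMeasure N K ≤
      (volume.restrict (unitBallExterior N : Set (EuclideanSpace ℝ (Fin N)))).withDensity
        fun x => ENNReal.ofReal C * ‖‖x‖ ^ (-c)‖ₑ ^ (p : ℝ) := by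
    refine withDensity_mono ?_
    filter_upwards [ae_restrict_mem ExteriorTest.measurableSet_exterior] with x hx
    have hx1 : 1 < ‖x‖ := hx
    rw [Real.enorm_of_nonneg (by positivity),
      ENNReal.ofReal_rpow_of_nonneg (by positivity) (by positivity), ← ENNReal.ofReal_mul hC,
      ← Real.rpow_mul (by positivity), neg_mul, hcp, Real.rpow_neg (by positivity),
      ← div_eq_mul_inv]
    exact ENNReal.ofReal_le_ofReal (hK x hx)
  refine (lintegral_mono' hle le_rfl).trans_eq ?_
  rw [lintegral_withDensity_eq_lintegral_mul _ hm hg,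
    ← lintegral_const_mul _ (by fun_prop)]
  simp [mul_assoc]

theorem lt_div_mul_of_lt {γ : ℝ} {p : ℝ≥0} (hp : NNReal.HolderConjugate N p) (hγ : (N : ℝ) < γ) :
    (N : ℝ) < γ / p * p := by
  rwa [div_mul_cancel₀]
  exact_mod_cast hp.symm.ne_zero

variable [Fact (2 ≤ N)]

theorem exists_holderConjugate_dim : ∃ p : ℝ≥0, NNReal.HolderConjugate N p := by
  have hN : 2 ≤ N := Fact.out
  exact ⟨_, NNReal.HolderConjugate.conjExponent (by exact_mod_cast hN)⟩

theorem isFiniteMeasure_weightedMeasure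
    (hK : ∃ C > (0 : ℝ), ∃ γ > (N : ℝ), ∀ x, 1 < ‖x‖ → K x ≤ C / ‖x‖ ^ γ) :
    IsFiniteMeasure (weightedMeasure N K) := by
  obtain ⟨C, hC, γ, hγ, hK⟩ := hK
  obtain ⟨p, hp⟩ := exists_holderConjugate_dim (N := N)
  have hp0 : p ≠ 0 := hp.symm.ne_zero
  -- The zeroth power of the iteration says only that the weight itself lies in L^p, which is
  -- finiteness of the measure.
  obtain ⟨D, hD⟩ := ExteriorTest.exists_eLpNorm_pow_mul_norm_rpow_le hp (lt_div_mul_of_lt hp hγ) 0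
  have h1 := lintegral_weightedMeasure_le hC.le (div_mul_cancel₀ γ (by exact_mod_cast hp0)) hK
    (g := fun _ => 1) measurable_const
  have h2 := hD 0
  simp only [pow_zero, one_mul, mul_one] at h1 h2
  refine ⟨?_⟩
  rw [← lintegral_one]
  refine h1.trans_lt (ENNReal.mul_lt_top ENNReal.ofReal_lt_top ?_)
  rw [← eLpNorm_nnreal_pow_eq_lintegral hp0]
  exact ENNReal.rpow_lt_top_of_nonneg (by positivity) (h2.trans_lt ENNReal.coe_lt_top).ne

/-- For an integer k > r, the iteration at power k with weight |x|^{-γ/p} is a bound in L^{kp}(K).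
Since kp ≥ r and the measure is finite, it descends to L^r(K). -/
theorem exists_eLpNorm_weightedMeasure_le
    (hK : ∃ C > (0 : ℝ), ∃ γ > (N : ℝ), ∀ x, 1 < ‖x‖ → K x ≤ C / ‖x‖ ^ γ)
    {r : ℝ≥0∞} (hr : r ≠ ∞) :
    ∃ D : ℝ≥0, ∀ φ : ExteriorTest N, eLpNorm φ r (weightedMeasure N K) ≤ D * ‖φ‖ₑ := by
  have := isFiniteMeasure_weightedMeasure hK
  obtain ⟨C, hC, γ, hγ, hK⟩ := hK
  obtain ⟨p, hp⟩ := exists_holderConjugate_dim (N := N)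
  have hp0 : p ≠ 0 := hp.symm.ne_zero
  have hp1 : 1 ≤ p := hp.symm.lt.le
  obtain ⟨k, hk⟩ := exists_nat_gt r.toNNReal
  have hk0 : k ≠ 0 := by
    rintro rfl
    simp at hk
  set q : ℝ≥0 := k * p with hq
  have hq0 : q ≠ 0 := by positivity
  have hqpos : 0 < (q : ℝ) := by positivity
  have hrq : r ≤ q := by
    rw [← ENNReal.coe_toNNReal hr]
    refine ENNReal.coe_le_coe.2 (hk.le.trans ?_)
    exact le_mul_of_one_le_right (by positivity) hp1
  obtain ⟨D, hD⟩ := ExteriorTest.exists_eLpNorm_pow_mul_norm_rpow_le hp (lt_div_mul_of_lt hp hγ) k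
  set A : ℝ≥0∞ := (ENNReal.ofReal C * (D : ℝ≥0∞) ^ (p : ℝ)) ^ (q : ℝ)⁻¹ with hA
  have hAtop : A ≠ ∞ := by
    refine ENNReal.rpow_ne_top_of_nonneg (by positivity) (ENNReal.mul_ne_top (by simp) ?_)
    exact ENNReal.rpow_ne_top_of_nonneg (by positivity) (by simp)
  have hmain : ∀ φ : ExteriorTest N, eLpNorm φ q (weightedMeasure N K) ≤ A * ‖φ‖ₑ := by
    intro φ
    have hφm : Measurable φ := φ.contDiff.continuous.measurable
    rw [← ENNReal.rpow_le_rpow_iff hqpos, eLpNorm_nnreal_pow_eq_lintegral hq0]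
    refine (lintegral_weightedMeasure_le hC.le (div_mul_cancel₀ γ (by exact_mod_cast hp0)) hK
      (by fun_prop)).trans ?_
    have h1 : ∀ x, ‖‖x‖ ^ (-(γ / p))‖ₑ ^ (p : ℝ) * ‖φ x‖ₑ ^ (q : ℝ) =
        ‖φ x ^ k * ‖x‖ ^ (-(γ / p))‖ₑ ^ (p : ℝ) := by
      intro x
      rw [enorm_mul, enorm_pow, ENNReal.mul_rpow_of_nonneg _ _ (by positivity),
        ← ENNReal.rpow_natCast_mul, mul_comm, hq]
      push_cast
      rfl
    simp_rw [h1]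
    rw [← eLpNorm_nnreal_pow_eq_lintegral hp0, ENNReal.mul_rpow_of_nonneg _ _ (by positivity), hA,
      ENNReal.rpow_inv_rpow hqpos.ne', mul_assoc]
    refine mul_le_mul_right ((ENNReal.rpow_le_rpow (hD φ) (by positivity)).trans_eq ?_) _
    rw [ENNReal.mul_rpow_of_nonneg _ _ (by positivity), ← ENNReal.rpow_natCast_mul, hq]
    push_cast
    rfl
  set B : ℝ≥0∞ := weightedMeasure N K Set.univ ^ (1 / r.toReal - 1 / (q : ℝ≥0∞).toReal)
  rcases eq_or_ne r 0 with rfl | hr0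
  · exact ⟨0, fun φ => by simp⟩
  have hB : B ≠ ∞ := by
    refine ENNReal.rpow_ne_top_of_nonneg ?_ (measure_ne_top _ _)
    rw [sub_nonneg]
    exact one_div_le_one_div_of_le (ENNReal.toReal_pos hr0 hr) (ENNReal.toReal_mono (by simp) hrq)
  refine ⟨(A * B).toNNReal, fun φ => ?_⟩
  rw [ENNReal.coe_toNNReal (ENNReal.mul_ne_top hAtop hB), mul_right_comm]
  exact (eLpNorm_le_eLpNorm_mul_rpow_measure_univ hrq
    φ.contDiff.continuous.aestronglyMeasurable).trans (mul_le_mul_left (hmain φ) _)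

theorem memLp_weightedMeasure
    (hK : ∃ C > (0 : ℝ), ∃ γ > (N : ℝ), ∀ x, 1 < ‖x‖ → K x ≤ C / ‖x‖ ^ γ)
    {r : ℝ≥0∞} (hr : r ≠ ∞) (φ : ExteriorTest N) : MemLp φ r (weightedMeasure N K) := by
  obtain ⟨D, hD⟩ := exists_eLpNorm_weightedMeasure_le hK hr
  exact ⟨φ.contDiff.continuous.aestronglyMeasurable,
    (hD φ).trans_lt (ENNReal.mul_lt_top ENNReal.coe_lt_top enorm_lt_top)⟩

/-- The inclusion of the test functions into the weighted Lebesgue space is bounded. -/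
theorem exists_testInclusion
    (hK : ∃ C > (0 : ℝ), ∃ γ > (N : ℝ), ∀ x, 1 < ‖x‖ → K x ≤ C / ‖x‖ ^ γ)
    {r : ℝ≥0∞} [Fact (1 ≤ r)] (hr : r ≠ ∞) :
    ∃ T : ExteriorTest N →L[ℝ] Lp ℝ r (weightedMeasure N K),
      ∀ φ, T φ = (memLp_weightedMeasure hK hr φ).toLp φ := by
  obtain ⟨D, hD⟩ := exists_eLpNorm_weightedMeasure_le hK hr
  let L : ExteriorTest N →ₗ[ℝ] Lp ℝ r (weightedMeasure N K) :=
    { toFun := fun φ => (memLp_weightedMeasure hK hr φ).toLp φ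
      map_add' := fun φ ψ => MemLp.toLp_add _ _
      map_smul' := fun c φ => MemLp.toLp_const_smul _ _ }
  refine ⟨L.mkContinuous D fun φ => ?_, fun φ => rfl⟩
  change ‖(memLp_weightedMeasure hK hr φ).toLp φ‖ ≤ _
  rw [Lp.norm_toLp]
  refine ENNReal.toReal_le_of_le_ofReal (by positivity) ((hD φ).trans_eq ?_)
  rw [ENNReal.ofReal_mul (by positivity), ofReal_norm, ENNReal.ofReal_coe_nnreal]

end Weighted

/-! ### A finite-functional criterion for total boundedness -/

/-- The image of the unit ball under S is bounded in finite dimension, so it has a finite δ-net.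
Preimages of the net in the unit ball give an ε-net for T. The radius 2 allows for differences of
two points of the unit ball. -/
theorem ContinuousLinearMap.totallyBounded_image_ball_of_finite_functionals
    {X Y : Type*} [SeminormedAddCommGroup X] [NormedSpace ℝ X]
    [SeminormedAddCommGroup Y] [NormedSpace ℝ Y] (T : X →L[ℝ] Y)
    (h : ∀ ε > 0, ∃ (ι : Type) (_ : Fintype ι) (S : X →L[ℝ] (ι → ℝ)), ∃ δ > 0,
      ∀ x, ‖x‖ ≤ 2 → ‖S x‖ ≤ δ → ‖T x‖ < ε) :
    TotallyBounded (T '' Metric.ball 0 1) := by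
  refine Metric.totallyBounded_iff.2 fun ε hε => ?_
  obtain ⟨ι, _, S, δ, hδ, hS⟩ := h ε hε
  have hb : TotallyBounded (S '' Metric.ball 0 1) :=
    (Bornology.IsBounded.isCompact_closure
      (S.lipschitz.isBounded_image Metric.isBounded_ball)).totallyBounded.subset subset_closure
  obtain ⟨t, ht, htf, hcov⟩ := Metric.finite_approx_of_totallyBounded hb δ hδ
  obtain ⟨u, hu, huf, rfl⟩ := htf.exists_subset_finite_image_eq ht
  refine ⟨T '' u, huf.image _, ?_⟩
  rintro _ ⟨x, hx, rfl⟩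
  have hx' := hcov (Set.mem_image_of_mem S hx)
  simp only [Set.mem_iUnion] at hx' ⊢
  obtain ⟨_, ⟨y, hy, rfl⟩, hxy⟩ := hx'
  refine ⟨_, ⟨y, hy, rfl⟩, ?_⟩
  rw [mem_ball_iff_norm, ← map_sub] at hxy ⊢
  refine hS _ ?_ hxy.le
  have h1 := mem_ball_zero_iff.1 hx
  have h2 := mem_ball_zero_iff.1 (hu hy)
  linarith [norm_sub_le x y]

theorem exists_ofReal_mul_le {a b : ℝ≥0∞} (ha : a ≠ ∞) (hb : b ≠ 0) :
    ∃ τ : ℝ, 0 < τ ∧ τ ≤ 1 ∧ ENNReal.ofReal τ * a ≤ b := by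
  have h : Filter.Tendsto (fun τ : ℝ => ENNReal.ofReal τ * a) (nhdsWithin 0 (Set.Ioi 0))
      (nhds 0) := by
    have := ENNReal.Tendsto.mul_const (b := a)
      ((ENNReal.continuous_ofReal.tendsto 0).mono_left (nhdsWithin_le_nhds (s := Set.Ioi 0)))
      (Or.inr ha)
    simpa using this
  have h1 : ∀ᶠ τ : ℝ in nhdsWithin 0 (Set.Ioi 0), ENNReal.ofReal τ * a ≤ b :=
    h.eventually (ge_mem_nhds (pos_iff_ne_zero.2 hb))
  have h2 : ∀ᶠ τ : ℝ in nhdsWithin 0 (Set.Ioi 0), τ ∈ Set.Ioc (0 : ℝ) 1 :=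
    Ioc_mem_nhdsGT one_pos
  obtain ⟨τ, h3, h4⟩ := (h1.and h2).exists
  exact ⟨τ, h4.1, h4.2, h3⟩

/-! ### Local L¹ control by integrals over small balls -/

namespace ExteriorTest

variable {N : ℕ}

theorem integrableOn_ball_comp_add (φ : ExteriorTest N) (x : EuclideanSpace ℝ (Fin N)) (ρ : ℝ) :
    IntegrableOn (fun h => φ (x + h)) (Metric.ball 0 ρ) := by
  have hc : Continuous fun h => φ (x + h) := by
    have := φ.contDiff.continuous
    fun_prop
  exact (hc.continuousOn.integrableOn_compact (isCompact_closedBall 0 ρ)).mono_set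
    Metric.ball_subset_closedBall

variable [Fact (2 ≤ N)]

theorem exists_setLIntegral_ball_enorm_grad_le (R : ℝ) :
    ∃ G : ℝ≥0, ∀ φ : ExteriorTest N,
      ∫⁻ x in Metric.ball 0 R, ‖∇ φ x‖ₑ ≤ G * ‖φ‖ₑ := by
  have hN : 2 ≤ N := Fact.out
  set B : ℝ≥0∞ := volume (Metric.ball (0 : EuclideanSpace ℝ (Fin N)) R) ^
    (1 - 1 / (N : ℝ))
  have hB : B ≠ ∞ := by
    refine ENNReal.rpow_ne_top_of_nonneg ?_ measure_ball_lt_top.ne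
    rw [sub_nonneg]
    exact div_le_one_of_le₀ (by exact_mod_cast (by lia : 1 ≤ N)) (by positivity)
  refine ⟨B.toNNReal, fun φ => ?_⟩
  have h1 := eLpNorm_le_eLpNorm_mul_rpow_measure_univ
    (μ := volume.restrict (Metric.ball (0 : EuclideanSpace ℝ (Fin N)) R))
    (p := 1) (q := N) (by exact_mod_cast (by lia : 1 ≤ N))
    φ.continuous_grad.aestronglyMeasurable
  rw [eLpNorm_one_eq_lintegral_enorm] at h1
  simp only [Measure.restrict_apply_univ, ENNReal.toReal_one, div_one,
    ENNReal.toReal_natCast] at h1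
  rw [ENNReal.coe_toNNReal hB, mul_comm, enorm_eq_eLpNorm, eLpNorm_restrict_eq_of_support_subset]
  · exact h1.trans (mul_le_mul_left (eLpNorm_mono_measure _ Measure.restrict_le_self) _)
  · exact Function.support_subset_iff'.2 fun x hx => φ.grad_eq_zero hx

theorem exists_setLIntegral_ball_enorm_add_sub_le (R H : ℝ) :
    ∃ G : ℝ≥0, ∀ (φ : ExteriorTest N) (h : EuclideanSpace ℝ (Fin N)), ‖h‖ ≤ H →
      ∫⁻ x in Metric.ball 0 R, ‖φ (x + h) - φ x‖ₑ ≤ ‖h‖ₑ * (G * ‖φ‖ₑ) := by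
  obtain ⟨G, hG⟩ := exists_setLIntegral_ball_enorm_grad_le (N := N) (R + H)
  refine ⟨G, fun φ h hh => ?_⟩
  refine (setLIntegral_ball_enorm_add_sub_le volume (φ.contDiff.of_le (by simp)) R h).trans ?_
  refine mul_le_mul_right (le_trans ?_ (hG φ)) _
  simp_rw [enorm_grad]
  exact lintegral_mono_set (Metric.ball_subset_ball (by linarith))

/-- Integration over small balls defines continuous linear functionals. -/
theorem exists_ballIntegral {ρ : ℝ} (hρ : ρ ≤ 1) (x : EuclideanSpace ℝ (Fin N)) :
    ∃ L : ExteriorTest N →L[ℝ] ℝ, ∀ φ, L φ = ∫ h in Metric.ball 0 ρ, φ (x + h) := by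
  obtain ⟨G, hG⟩ := exists_setLIntegral_ball_enorm_add_sub_le (N := N) ρ ‖x‖
  let L : ExteriorTest N →ₗ[ℝ] ℝ :=
    { toFun := fun φ => ∫ h in Metric.ball 0 ρ, φ (x + h)
      map_add' := fun φ ψ => integral_add (φ.integrableOn_ball_comp_add x ρ)
        (ψ.integrableOn_ball_comp_add x ρ)
      map_smul' := fun c φ => integral_const_mul _ _ }
  refine ⟨L.mkContinuous (‖x‖ * G) fun φ => ?_, fun φ => rfl⟩
  change ‖∫ h in Metric.ball 0 ρ, φ (x + h)‖ ≤ _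
  -- As ρ ≤ 1, φ vanishes on the ρ-ball about 0, so φ(x + h) is the increment φ(h + x) - φ(h) and
  -- the translation estimate with shift x applies.
  have h1 : ‖∫ h in Metric.ball 0 ρ, φ (x + h)‖ₑ ≤ ‖x‖ₑ * (G * ‖φ‖ₑ) := by
    refine (enorm_integral_le_lintegral_enorm _).trans (le_of_eq_of_le ?_ (hG φ x le_rfl))
    refine setLIntegral_congr_fun measurableSet_ball fun h hh => ?_
    have hz : φ h = 0 := by
      refine (φ.eventuallyEq_zero (x := h) fun hmem => ?_).self_of_nhds
      have : 1 < ‖h‖ := hmem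
      linarith [mem_ball_zero_iff.1 hh]
    rw [hz, sub_zero, add_comm]
  rw [← ENNReal.ofReal_le_ofReal_iff (by positivity), ofReal_norm]
  refine h1.trans_eq ?_
  rw [ENNReal.ofReal_mul (by positivity), ENNReal.ofReal_mul (by positivity), ofReal_norm,
    ofReal_norm, ENNReal.ofReal_coe_nnreal, mul_assoc]

/-- Moving the centre from y to x translates φ by x - y over a ball inside the (R+1)-ball. This
Lipschitz dependence lets a finite net of centres suffice. -/
theorem exists_enorm_ballIntegral_sub_le (R : ℝ) :
    ∃ G : ℝ≥0, ∀ (φ : ExteriorTest N) (x y : EuclideanSpace ℝ (Fin N)) (ρ : ℝ), ρ ≤ 1 →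
      y ∈ Metric.ball 0 R → ‖x - y‖ ≤ 1 →
      ‖(∫ h in Metric.ball 0 ρ, φ (x + h)) - ∫ h in Metric.ball 0 ρ, φ (y + h)‖ₑ ≤
        ‖x - y‖ₑ * (G * ‖φ‖ₑ) := by
  obtain ⟨G, hG⟩ := exists_setLIntegral_ball_enorm_add_sub_le (N := N) (R + 1) 1
  refine ⟨G, fun φ x y ρ hρ hy hxy => ?_⟩
  rw [← integral_sub (φ.integrableOn_ball_comp_add x ρ) (φ.integrableOn_ball_comp_add y ρ)]
  refine (enorm_integral_le_lintegral_enorm _).trans (le_trans ?_ (hG φ (x - y) hxy))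
  rw [← lintegral_indicator measurableSet_ball, ← lintegral_indicator measurableSet_ball,
    ← lintegral_add_left_eq_self ((Metric.ball 0 (R + 1)).indicator
      fun z => ‖φ (z + (x - y)) - φ z‖ₑ) y]
  refine lintegral_mono fun h => ?_
  by_cases hh : h ∈ Metric.ball 0 ρ
  · have hm : y + h ∈ Metric.ball 0 (R + 1) := by
      rw [mem_ball_zero_iff] at *
      linarith [norm_add_le y h]
    rw [Set.indicator_of_mem hh, Set.indicator_of_mem hm,
      show y + h + (x - y) = x + h by abel]
  · rw [Set.indicator_of_notMem hh]
    exact zero_le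

/-- φ(x) differs from its mean over the ρ-ball around x by an average of increments φ(x + h) - φ(x)
with |h| < ρ. After integrating in x and exchanging integrals, each increment costs O(ρ). -/
theorem exists_volume_mul_setLIntegral_ball_le (R : ℝ) :
    ∃ G : ℝ≥0, ∀ (φ : ExteriorTest N) (ρ : ℝ), 0 < ρ → ρ ≤ 1 →
      volume (Metric.ball (0 : EuclideanSpace ℝ (Fin N)) ρ) * ∫⁻ x in Metric.ball 0 R, ‖φ x‖ₑ ≤
        (∫⁻ x in Metric.ball 0 R, ‖∫ h in Metric.ball 0 ρ, φ (x + h)‖ₑ) +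
        volume (Metric.ball (0 : EuclideanSpace ℝ (Fin N)) ρ) *
          (ENNReal.ofReal ρ * (G * ‖φ‖ₑ)) := by
  obtain ⟨G, hG⟩ := exists_setLIntegral_ball_enorm_add_sub_le (N := N) R 1
  refine ⟨G, fun φ ρ hρ0 hρ => ?_⟩
  have hφ := φ.contDiff.continuous
  set V := volume (Metric.ball (0 : EuclideanSpace ℝ (Fin N)) ρ) with hV
  have hVtop : V ≠ ∞ := measure_ball_lt_top.ne
  have hpt : ∀ x, V * ‖φ x‖ₑ ≤ ‖∫ h in Metric.ball 0 ρ, φ (x + h)‖ₑ +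
      ∫⁻ h in Metric.ball 0 ρ, ‖φ (x + h) - φ x‖ₑ := by
    intro x
    have hi : IntegrableOn (fun _ => φ x) (Metric.ball (0 : EuclideanSpace ℝ (Fin N)) ρ) :=
      integrableOn_const hVtop
    have h1 : V * ‖φ x‖ₑ = ‖∫ h in Metric.ball (0 : EuclideanSpace ℝ (Fin N)) ρ, φ x‖ₑ := by
      rw [setIntegral_const, enorm_smul, Measure.real, Real.enorm_of_nonneg ENNReal.toReal_nonneg,
        ENNReal.ofReal_toReal hVtop]
    have h2 : ∫ h in Metric.ball (0 : EuclideanSpace ℝ (Fin N)) ρ, φ x =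
        (∫ h in Metric.ball 0 ρ, φ (x + h)) - ∫ h in Metric.ball 0 ρ, (φ (x + h) - φ x) := by
      rw [integral_sub (φ.integrableOn_ball_comp_add x ρ) hi, sub_sub_cancel]
    rw [h1, h2]
    exact enorm_sub_le.trans (add_le_add_right (enorm_integral_le_lintegral_enorm _) _)
  have hm : Measurable fun p : EuclideanSpace ℝ (Fin N) × EuclideanSpace ℝ (Fin N) =>
      ‖φ (p.1 + p.2) - φ p.1‖ₑ := by
    refine Continuous.measurable ?_
    fun_prop
  rw [← lintegral_const_mul _ (by fun_prop)]
  refine (lintegral_mono hpt).trans ?_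
  rw [lintegral_add_right _ (hm.lintegral_prod_right')]
  refine add_le_add_right ?_ _
  rw [lintegral_lintegral_swap hm.aemeasurable]
  calc _ ≤ ∫⁻ h in Metric.ball (0 : EuclideanSpace ℝ (Fin N)) ρ,
        ENNReal.ofReal ρ * (G * ‖φ‖ₑ) := by
        refine setLIntegral_mono' measurableSet_ball fun h hh => ?_
        have hh' := mem_ball_zero_iff.1 hh
        refine (hG φ h (by linarith)).trans (mul_le_mul_left ?_ _)
        rw [← ofReal_norm]
        exact ENNReal.ofReal_le_ofReal hh'.le
    _ = _ := by rw [setLIntegral_const, mul_comm]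

/-- On bounded sets, the `L¹` norm of test functions with bounded gradient norm is controlled by
finitely many functionals. -/
theorem exists_finite_functionals_setLIntegral_ball_le (R : ℝ) {η : ℝ≥0∞} (hη : η ≠ 0) :
    ∃ (ι : Type) (_ : Fintype ι) (S : ExteriorTest N →L[ℝ] (ι → ℝ)), ∃ δ > 0,
      ∀ φ, ‖φ‖ ≤ 2 → ‖S φ‖ ≤ δ → ∫⁻ x in Metric.ball 0 R, ‖φ x‖ₑ ≤ η := by
  obtain ⟨G₁, hG₁⟩ := exists_volume_mul_setLIntegral_ball_le (N := N) R
  obtain ⟨G₂, hG₂⟩ := exists_enorm_ballIntegral_sub_le (N := N) R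
  -- ρ makes the error of replacing φ by its means at most η/2; the factor 2 is the bound on ‖φ‖.
  obtain ⟨ρ, hρ0, hρ1, hρ⟩ := exists_ofReal_mul_le (a := G₁ * 2) (b := η / 2)
    (ENNReal.mul_ne_top (by simp) (by simp)) (by simpa using hη)
  set V := volume (Metric.ball (0 : EuclideanSpace ℝ (Fin N)) ρ) with hV
  have hVtop : V ≠ ∞ := measure_ball_lt_top.ne
  have hV0 : V ≠ 0 := (Metric.measure_ball_pos _ _ hρ0).ne'
  set W := volume (Metric.ball (0 : EuclideanSpace ℝ (Fin N)) R) with hW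
  -- τ serves both as the mesh of the net of centres and as the bound δ on the functionals, whence
  -- the factor 1 + 2G₂.
  obtain ⟨τ, hτ0, hτ1, hτ⟩ := exists_ofReal_mul_le (a := (1 + G₂ * 2) * W) (b := V * (η / 2))
    (ENNReal.mul_ne_top (ENNReal.add_ne_top.2 ⟨by simp, ENNReal.mul_ne_top (by simp) (by simp)⟩)
      measure_ball_lt_top.ne) (mul_ne_zero hV0 (by simpa using hη))
  obtain ⟨t, ht, htf, hcov⟩ := Metric.finite_approx_of_totallyBounded
    ((isCompact_closedBall (0 : EuclideanSpace ℝ (Fin N)) R).totallyBounded.subset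
      Metric.ball_subset_closedBall) τ hτ0
  choose L hL using fun x : EuclideanSpace ℝ (Fin N) => exists_ballIntegral hρ1 x
  have := htf.fintype
  obtain ⟨n, ⟨e⟩⟩ := Finite.exists_equiv_fin t
  refine ⟨Fin n, inferInstance, ContinuousLinearMap.pi fun i => L (e.symm i), τ, hτ0,
    fun φ hφ hS => ?_⟩
  have hφe : ‖φ‖ₑ ≤ 2 := by
    rw [← ofReal_norm]
    exact (ENNReal.ofReal_le_ofReal hφ).trans_eq (by simp)
  have hbound : ∀ x ∈ Metric.ball 0 R, ‖∫ h in Metric.ball 0 ρ, φ (x + h)‖ₑ ≤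
      ENNReal.ofReal τ * (1 + G₂ * 2) := by
    intro x hx
    have hx' := hcov hx
    simp only [Set.mem_iUnion] at hx'
    obtain ⟨y, hy, hxy⟩ := hx'
    rw [mem_ball_iff_norm] at hxy
    have h1 : ‖∫ h in Metric.ball 0 ρ, φ (y + h)‖ₑ ≤ ENNReal.ofReal τ := by
      rw [← ofReal_norm, ← hL]
      refine ENNReal.ofReal_le_ofReal (le_trans ?_ hS)
      have := norm_le_pi_norm ((ContinuousLinearMap.pi fun i => L (e.symm i)) φ) (e ⟨y, hy⟩)
      simpa using this
    have h2 := hG₂ φ x y ρ hρ1 (ht hy) (hxy.le.trans hτ1)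
    have h3 : ‖x - y‖ₑ ≤ ENNReal.ofReal τ := by
      rw [← ofReal_norm]
      exact ENNReal.ofReal_le_ofReal hxy.le
    calc ‖∫ h in Metric.ball 0 ρ, φ (x + h)‖ₑ
        = ‖(∫ h in Metric.ball 0 ρ, φ (y + h)) + ((∫ h in Metric.ball 0 ρ, φ (x + h)) -
            ∫ h in Metric.ball 0 ρ, φ (y + h))‖ₑ := by rw [add_sub_cancel]
      _ ≤ ENNReal.ofReal τ + ENNReal.ofReal τ * (G₂ * 2) :=
        (enorm_add_le _ _).trans (add_le_add h1 (h2.trans (by gcongr)))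
      _ = _ := by ring
  rw [← ENNReal.mul_le_mul_iff_right hV0 hVtop]
  calc V * ∫⁻ x in Metric.ball 0 R, ‖φ x‖ₑ
      ≤ ENNReal.ofReal τ * (1 + G₂ * 2) * W + V * (ENNReal.ofReal ρ * (G₁ * 2)) := by
        refine (hG₁ φ ρ hρ0 hρ1).trans (add_le_add ?_ (by gcongr))
        refine (setLIntegral_mono' measurableSet_ball hbound).trans_eq ?_
        rw [setLIntegral_const]
    _ ≤ V * (η / 2) + V * (η / 2) := by
        refine add_le_add ?_ (by gcongr)
        rwa [mul_assoc]
    _ = V * η := by rw [← mul_add, ENNReal.add_halves]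

end ExteriorTest

/-! ### Compactness in the weighted spaces -/

section Compactness

variable {N : ℕ} {K : EuclideanSpace ℝ (Fin N) → ℝ}

theorem setLIntegral_weightedMeasure_le {C γ : ℝ} (hC : 0 ≤ C) (hγ : 0 ≤ γ)
    (hK : ∀ x, 1 < ‖x‖ → K x ≤ C / ‖x‖ ^ γ) {s : Set (EuclideanSpace ℝ (Fin N))}
    (hs : MeasurableSet s) {g : EuclideanSpace ℝ (Fin N) → ℝ≥0∞} (hg : Measurable g) :
    ∫⁻ x in s, g x ∂weightedMeasure N K ≤ ENNReal.ofReal C * ∫⁻ x in s, g x := by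
  rw [← lintegral_indicator hs, ← lintegral_indicator hs]
  refine (lintegral_weightedMeasure_le (p := 1) hC (mul_one γ) hK (hg.indicator hs)).trans ?_
  refine mul_le_mul_right (le_trans ?_
    (setLIntegral_le_lintegral (unitBallExterior N : Set (EuclideanSpace ℝ (Fin N))) _)) _
  refine setLIntegral_mono' ExteriorTest.measurableSet_exterior fun x hx => ?_
  have hx1 : 1 < ‖x‖ := hx
  refine mul_le_of_le_one_left' ?_
  rw [NNReal.coe_one, ENNReal.rpow_one, Real.enorm_of_nonneg (by positivity),
    ← ENNReal.ofReal_one]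
  exact ENNReal.ofReal_le_ofReal (Real.rpow_le_one_of_one_le_of_nonpos hx1.le (by linarith))

variable [Fact (2 ≤ N)]

/-- On a large ball K is bounded by C, so the local L¹ control applies. Off the ball, Cauchy–Schwarz
plays the L²(K) bound against the small remaining mass of a finite measure. -/
theorem exists_finite_functionals_lintegral_weightedMeasure_le
    (hK : ∃ C > (0 : ℝ), ∃ γ > (N : ℝ), ∀ x, 1 < ‖x‖ → K x ≤ C / ‖x‖ ^ γ)
    {η : ℝ≥0∞} (hη : η ≠ 0) :
    ∃ (ι : Type) (_ : Fintype ι) (S : ExteriorTest N →L[ℝ] (ι → ℝ)), ∃ δ > 0,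
      ∀ φ, ‖φ‖ ≤ 2 → ‖S φ‖ ≤ δ → ∫⁻ x, ‖φ x‖ₑ ∂weightedMeasure N K ≤ η := by
  have := isFiniteMeasure_weightedMeasure hK
  obtain ⟨D, hD⟩ := exists_eLpNorm_weightedMeasure_le hK (r := 2) (by simp)
  obtain ⟨C, hC, γ, hγ, hK⟩ := hK
  have hη2 : η / 2 ≠ 0 := by simpa using hη
  obtain ⟨θ, hθ0, -, hθ⟩ := exists_ofReal_mul_le (a := D * 2) (b := η / 2)
    (ENNReal.mul_ne_top (by simp) (by simp)) hη2
  -- The mass is taken below θ² because Cauchy–Schwarz takes its square root.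
  obtain ⟨Q, -, hQ, hμQ⟩ := MeasurableSet.univ.exists_isCompact_sdiff_lt
    (μ := weightedMeasure N K) (measure_ne_top _ _) (ε := ENNReal.ofReal θ ^ (2 : ℝ))
    (by simpa using hθ0)
  obtain ⟨R, hR⟩ := hQ.isBounded.subset_ball (0 : EuclideanSpace ℝ (Fin N))
  obtain ⟨ι, hι, S, δ, hδ, hS⟩ := ExteriorTest.exists_finite_functionals_setLIntegral_ball_le
    (N := N) R (η := η / 2 / ENNReal.ofReal C) (ENNReal.div_ne_zero.2 ⟨hη2, by simp⟩)
  refine ⟨ι, hι, S, δ, hδ, fun φ hφ hSφ => ?_⟩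
  have hφc := φ.contDiff.continuous
  have hφe : ‖φ‖ₑ ≤ 2 := by
    rw [← ofReal_norm]
    exact (ENNReal.ofReal_le_ofReal hφ).trans_eq (by simp)
  rw [← lintegral_add_compl _ (measurableSet_ball (x := 0) (ε := R)), ← ENNReal.add_halves η]
  refine add_le_add ?_ ?_
  · have hγ0 : 0 ≤ γ := (Nat.cast_nonneg N).trans hγ.le
    refine (setLIntegral_weightedMeasure_le hC.le hγ0 hK measurableSet_ball
      hφc.enorm.measurable).trans ?_
    refine (mul_le_mul_right (hS φ hφ hSφ) _).trans_eq ?_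
    rw [ENNReal.mul_div_cancel (by simpa using hC) (by simp)]
  · have h1 := eLpNorm_le_eLpNorm_mul_rpow_measure_univ
      (μ := (weightedMeasure N K).restrict (Metric.ball 0 R)ᶜ) (p := 1) (q := 2) (f := φ)
      (by simp) hφc.aestronglyMeasurable
    rw [eLpNorm_one_eq_lintegral_enorm, Measure.restrict_apply_univ] at h1
    have h2 : (weightedMeasure N K) (Metric.ball 0 R)ᶜ ≤ ENNReal.ofReal θ ^ (2 : ℝ) := by
      refine (measure_mono ?_).trans hμQ.le
      rw [← Set.compl_eq_univ_sdiff]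
      exact Set.compl_subset_compl.2 hR
    refine h1.trans (le_trans ?_ hθ)
    rw [mul_comm]
    refine mul_le_mul' ?_ ?_
    · refine (ENNReal.rpow_le_rpow h2 (by norm_num)).trans_eq ?_
      rw [← ENNReal.rpow_mul]
      norm_num
    · refine (eLpNorm_mono_measure _ Measure.restrict_le_self).trans ((hD φ).trans ?_)
      gcongr

theorem exists_finite_functionals_eLpNorm_weightedMeasure_le
    (hK : ∃ C > (0 : ℝ), ∃ γ > (N : ℝ), ∀ x, 1 < ‖x‖ → K x ≤ C / ‖x‖ ^ γ)
    {r : ℝ≥0∞} (hr1 : 1 ≤ r) (hr : r ≠ ∞) {ε : ℝ≥0∞} (hε : ε ≠ 0) :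
    ∃ (ι : Type) (_ : Fintype ι) (S : ExteriorTest N →L[ℝ] (ι → ℝ)), ∃ δ > 0,
      ∀ φ, ‖φ‖ ≤ 2 → ‖S φ‖ ≤ δ → eLpNorm φ r (weightedMeasure N K) ≤ ε := by
  lift r to ℝ≥0 using hr
  have hr1' : 1 ≤ r := by exact_mod_cast hr1
  have hr1R : (1 : ℝ) ≤ r := by exact_mod_cast hr1'
  have hr0 : r ≠ 0 := (zero_lt_one.trans_le hr1').ne'
  -- With q = 2r - 1 one has r = 1/2 + q/2, so Cauchy–Schwarz interpolates L^r between L¹ and L^q.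
  -- The truncated subtraction is exact as 1 ≤ r.
  set q : ℝ≥0 := r + (r - 1) with hq
  have hqR : (q : ℝ) = 2 * r - 1 := by
    rw [hq, NNReal.coe_add, NNReal.coe_sub hr1']
    push_cast
    ring
  have hq0 : q ≠ 0 := by
    rw [← NNReal.coe_ne_zero, hqR]
    linarith
  obtain ⟨D, hD⟩ := exists_eLpNorm_weightedMeasure_le hK (r := q) (by simp)
  set M : ℝ≥0∞ := ((D : ℝ≥0∞) * 2) ^ (q : ℝ) with hM
  have hMtop : M ≠ ∞ :=
    ENNReal.rpow_ne_top_of_nonneg (by positivity) (ENNReal.mul_ne_top (by simp) (by simp))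
  obtain ⟨η, hη0, -, hη⟩ := exists_ofReal_mul_le (b := ε ^ (2 * r : ℝ)) hMtop
    (by simp [ENNReal.rpow_eq_zero_iff, hε])
  obtain ⟨ι, hι, S, δ, hδ, hS⟩ := exists_finite_functionals_lintegral_weightedMeasure_le hK
    (η := ENNReal.ofReal η) (by simpa using hη0)
  refine ⟨ι, hι, S, δ, hδ, fun φ hφ hSφ => ?_⟩
  have hφm : Measurable φ := φ.contDiff.continuous.measurable
  have hφe : ‖φ‖ₑ ≤ 2 := by
    rw [← ofReal_norm]
    exact (ENNReal.ofReal_le_ofReal hφ).trans_eq (by simp)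
  have hCS := ENNReal.lintegral_mul_le_Lp_mul_Lq (weightedMeasure N K) Real.HolderConjugate.two_two
    (f := fun x => ‖φ x‖ₑ ^ (1 / 2 : ℝ)) (g := fun x => ‖φ x‖ₑ ^ ((q : ℝ) / 2))
    (by fun_prop) (by fun_prop)
  have h1 : ∀ x, ((fun x => ‖φ x‖ₑ ^ (1 / 2 : ℝ)) * fun x => ‖φ x‖ₑ ^ ((q : ℝ) / 2)) x =
      ‖φ x‖ₑ ^ (r : ℝ) := by
    intro x
    rw [Pi.mul_apply, ← ENNReal.rpow_add_of_nonneg _ _ (by positivity) (by positivity), hqR]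
    congr 1
    ring
  simp only [h1] at hCS
  simp only [← ENNReal.rpow_mul, div_mul_cancel₀ _ (two_ne_zero (α := ℝ)), ENNReal.rpow_one] at hCS
  rw [← eLpNorm_nnreal_pow_eq_lintegral hq0, ← eLpNorm_nnreal_pow_eq_lintegral hr0,
    ← ENNReal.mul_rpow_of_nonneg _ _ (by positivity)] at hCS
  have hrpos : (0 : ℝ) < r := by linarith
  rw [← ENNReal.rpow_le_rpow_iff hrpos]
  refine hCS.trans ?_
  have h2 : ε ^ (r : ℝ) = (ε ^ (2 * r : ℝ)) ^ (1 / 2 : ℝ) := by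
    rw [← ENNReal.rpow_mul]
    congr 1
    ring
  rw [h2]
  refine ENNReal.rpow_le_rpow (le_trans ?_ hη) (by norm_num)
  refine mul_le_mul' (hS φ hφ hSφ) (ENNReal.rpow_le_rpow ((hD φ).trans ?_) (by positivity))
  gcongr

theorem isCompactOperator_of_testInclusion
    (hK : ∃ C > (0 : ℝ), ∃ γ > (N : ℝ), ∀ x, 1 < ‖x‖ → K x ≤ C / ‖x‖ ^ γ)
    {r : ℝ≥0∞} [Fact (1 ≤ r)] (hr : r ≠ ∞)
    (ι : BeppoLevi N →L[ℝ] Lp ℝ r (weightedMeasure N K))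
    (hι : ∀ φ : ExteriorTest N, ι (φ : BeppoLevi N) = (memLp_weightedMeasure hK hr φ).toLp φ) :
    IsCompactOperator ι := by
  set T : ExteriorTest N →L[ℝ] Lp ℝ r (weightedMeasure N K) :=
    ι.comp UniformSpace.Completion.toComplL
  have hT : ∀ φ, T φ = ι (φ : BeppoLevi N) := fun φ => rfl
  have htb : TotallyBounded (T '' Metric.ball 0 1) := by
    refine T.totallyBounded_image_ball_of_finite_functionals fun ε hε => ?_
    obtain ⟨κ, hκ, S, δ, hδ, hS⟩ := exists_finite_functionals_eLpNorm_weightedMeasure_le hK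
      (Fact.out : 1 ≤ r) hr (ε := ENNReal.ofReal (ε / 2)) (by simpa using hε)
    refine ⟨κ, hκ, S, δ, hδ, fun φ hφ hSφ => ?_⟩
    rw [hT, hι, Lp.norm_toLp]
    exact (ENNReal.toReal_le_of_le_ofReal (by positivity) (hS φ hφ hSφ)).trans_lt (half_lt_self hε)
  refine (isCompactOperator_iff_exists_mem_nhds_image_subset_compact _).2
    ⟨Metric.ball 0 1, Metric.ball_mem_nhds _ one_pos, closure (T '' Metric.ball 0 1),
      htb.closure.isCompact_of_isClosed isClosed_closure, ?_⟩
  rintro _ ⟨x, hx, rfl⟩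
  have hdense : Dense (Set.range ((↑) : ExteriorTest N → BeppoLevi N)) :=
    UniformSpace.Completion.denseRange_coe
  -- Since the unit ball is open, each of its points is a limit of test functions inside it, so the
  -- image stays in the closure of the image of the test functions.
  have hx' := hdense.open_subset_closure_inter Metric.isOpen_ball hx
  refine closure_mono ?_ (image_closure_subset_closure_image ι.continuous
    (Set.mem_image_of_mem ι hx'))
  rintro _ ⟨_, ⟨hφ, ⟨φ, rfl⟩⟩, rfl⟩
  refine ⟨φ, ?_, rfl⟩
  rw [mem_ball_zero_iff] at hφ ⊢
  rwa [UniformSpace.Completion.norm_coe] at hφ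

end Compactness

/-! ### Injectivity: closability of the gradient -/

section Injectivity

variable {N : ℕ}

/-- K is continuous and positive on the compact support of g, so the quotient by K is bounded there.
This turns unweighted pairings with derivatives of g into L¹(K) bounds. -/
theorem exists_norm_fderiv_le_mul {K : EuclideanSpace ℝ (Fin N) → ℝ}
    (hK_cont : ContinuousOn K {x | 1 < ‖x‖}) (hK_pos : ∀ x, 1 < ‖x‖ → 0 < K x)
    {g : EuclideanSpace ℝ (Fin N) → ℝ} (hg : ContDiff ℝ ((⊤ : ℕ∞) : WithTop ℕ∞) g)
    (hgc : HasCompactSupport g)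
    (hgs : tsupport g ⊆ (unitBallExterior N : Set (EuclideanSpace ℝ (Fin N)))) :
    ∃ M : ℝ≥0, ∀ x, 1 < ‖x‖ → ‖fderiv ℝ g x‖ ≤ M * K x := by
  have hcont : ContinuousOn (fun x => ‖fderiv ℝ g x‖ / K x) (tsupport g) :=
    (hg.continuous_fderiv (by simp)).norm.continuousOn.div (hK_cont.mono hgs)
      fun x hx => (hK_pos x (hgs hx)).ne'
  obtain ⟨M, hM⟩ := hgc.exists_bound_of_continuousOn hcont
  refine ⟨M.toNNReal, fun x hx => ?_⟩
  have hKx := hK_pos x hx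
  by_cases hxg : x ∈ tsupport g
  · have h1 := (le_abs_self _).trans (hM x hxg)
    rw [div_le_iff₀ hKx] at h1
    exact h1.trans (mul_le_mul_of_nonneg_right (Real.le_coe_toNNReal M) hKx.le)
  · rw [image_eq_zero_of_notMem_tsupport fun h => hxg (tsupport_fderiv_subset ℝ h), norm_zero]
    positivity

theorem lintegral_enorm_fderiv_mul_le {K : EuclideanSpace ℝ (Fin N) → ℝ}
    (hK_cont : ContinuousOn K {x | 1 < ‖x‖})
    {g : EuclideanSpace ℝ (Fin N) → ℝ} {M : ℝ≥0}
    (hM : ∀ x, 1 < ‖x‖ → ‖fderiv ℝ g x‖ ≤ M * K x) (v : EuclideanSpace ℝ (Fin N))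
    (φ : ExteriorTest N) :
    ∫⁻ x, ‖fderiv ℝ g x v * φ x‖ₑ ≤
      M * ‖v‖ₑ * ∫⁻ x, ‖φ x‖ₑ ∂weightedMeasure N K := by
  have hKm : AEMeasurable (fun x => ENNReal.ofReal (K x))
      (volume.restrict (unitBallExterior N : Set (EuclideanSpace ℝ (Fin N)))) :=
    (hK_cont.aemeasurable ExteriorTest.measurableSet_exterior).ennreal_ofReal
  have hφm : Measurable fun x => ‖φ x‖ₑ := φ.contDiff.continuous.enorm.measurable
  rw [weightedMeasure, lintegral_withDensity_eq_lintegral_mul₀ hKm hφm.aemeasurable,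
    ← lintegral_const_mul'' _ (hKm.mul hφm.aemeasurable),
    ← lintegral_indicator ExteriorTest.measurableSet_exterior]
  refine lintegral_mono fun x => ?_
  by_cases hx : x ∈ (unitBallExterior N : Set (EuclideanSpace ℝ (Fin N)))
  · rw [Set.indicator_of_mem hx, enorm_mul, Pi.mul_apply, ← mul_assoc]
    refine mul_le_mul_left ?_ _
    refine (ContinuousLinearMap.le_opENorm _ _).trans ?_
    rw [mul_right_comm]
    refine mul_le_mul_left ?_ _
    rw [← ofReal_norm, ← ENNReal.ofReal_coe_nnreal, ← ENNReal.ofReal_mul (by positivity)]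
    exact ENNReal.ofReal_le_ofReal (hM x hx)
  · rw [Set.indicator_of_notMem hx, (φ.eventuallyEq_zero hx).self_of_nhds]
    simp

theorem inner_setIntegral_smul_grad {g : EuclideanSpace ℝ (Fin N) → ℝ}
    (hg : ContDiff ℝ ((⊤ : ℕ∞) : WithTop ℕ∞) g) (hgc : HasCompactSupport g)
    (v : EuclideanSpace ℝ (Fin N)) (φ : ExteriorTest N) :
    inner ℝ v (∫ x in (unitBallExterior N : Set (EuclideanSpace ℝ (Fin N))), g x • ∇ φ x) =
      -∫ x, fderiv ℝ g x v * φ x := by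
  have hgcont := hg.continuous
  have hgd : Continuous (fun x => fderiv ℝ g x v) :=
    (hg.continuous_fderiv (by simp)).clm_apply continuous_const
  have hφcont := φ.contDiff.continuous
  have hφd : Continuous (fun x => fderiv ℝ φ x v) :=
    (φ.contDiff.continuous_fderiv (by simp)).clm_apply continuous_const
  have hi : Integrable (fun x => g x • ∇ φ x) :=
    (hgcont.smul φ.continuous_grad).integrable_of_hasCompactSupport hgc.smul_right
  rw [setIntegral_eq_integral_of_forall_compl_eq_zero
    (fun x hx => by rw [φ.grad_eq_zero hx, smul_zero]), ← integral_inner hi,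
    ← integral_mul_fderiv_eq_neg_fderiv_mul_of_integrable]
  · refine integral_congr_ae (.of_forall fun x => ?_)
    simp only
    rw [inner_smul_right, ExteriorTest.grad_eq, real_inner_comm,
      InnerProductSpace.toDual_symm_apply]
  · exact (hgd.mul hφcont).integrable_of_hasCompactSupport φ.hasCompactSupport.mul_left
  · exact (hgcont.mul hφd).integrable_of_hasCompactSupport hgc.mul_right
  · exact (hgcont.mul hφcont).integrable_of_hasCompactSupport hgc.mul_right
  · exact fun x _ => (hg.differentiable (by simp)) x
  · exact fun x _ => φ.differentiable x

variable [Fact (2 ≤ N)]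

instance fact_one_le_dim : Fact (1 ≤ (N : ℝ≥0∞)) :=
  ⟨by exact_mod_cast Nat.one_le_iff_ne_zero.mpr ExteriorTest.dim_ne_zero⟩

/-- The gradient extends to a linear map of the Beppo-Levi space into the vector-valued Lebesgue
space which preserves the norm. -/
theorem exists_beppoLeviGradient :
    ∃ G : BeppoLevi N →L[ℝ] Lp (EuclideanSpace ℝ (Fin N)) N
        (volume.restrict (unitBallExterior N : Set (EuclideanSpace ℝ (Fin N)))),
      (∀ φ : ExteriorTest N, G (φ : BeppoLevi N) = (φ.memLp_grad N).toLp (∇ φ)) ∧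
      ∀ u, ‖G u‖ = ‖u‖ := by
  let L : ExteriorTest N →ₗ[ℝ] Lp (EuclideanSpace ℝ (Fin N)) N
      (volume.restrict (unitBallExterior N : Set (EuclideanSpace ℝ (Fin N)))) :=
    { toFun := fun φ => (φ.memLp_grad N).toLp (∇ φ)
      map_add' := fun φ ψ => by
        rw [← MemLp.toLp_add]
        exact MemLp.toLp_congr _ _ (by rw [ExteriorTest.grad_add])
      map_smul' := fun c φ => by
        rw [RingHom.id_apply, ← MemLp.toLp_const_smul]
        exact MemLp.toLp_congr _ _ (by rw [ExteriorTest.grad_smul]) }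
  have hL : ∀ φ, ‖L φ‖ = ‖φ‖ := fun φ => by
    change ‖(φ.memLp_grad N).toLp (∇ φ)‖ = _
    rw [Lp.norm_toLp, ExteriorTest.norm_eq_eLpNorm ExteriorTest.dim_ne_zero]
  let L' := L.mkContinuous 1 fun φ => by rw [hL, one_mul]
  let G := L'.extend (UniformSpace.Completion.toComplL (𝕜 := ℝ) (E := ExteriorTest N))
  have hG : ∀ φ : ExteriorTest N, G (φ : BeppoLevi N) = L φ := fun φ =>
    L'.extend_eq (e := UniformSpace.Completion.toComplL)
      UniformSpace.Completion.denseRange_coe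
      (UniformSpace.Completion.isUniformInducing_coe _) φ
  refine ⟨G, hG, fun u => ?_⟩
  induction u using UniformSpace.Completion.induction_on with
  | hp => exact isClosed_eq (by fun_prop) (by fun_prop)
  | ih φ => rw [hG, hL, UniformSpace.Completion.norm_coe]

theorem injective_of_testInclusion {K : EuclideanSpace ℝ (Fin N) → ℝ}
    (hK_cont : ContinuousOn K {x | 1 < ‖x‖}) (hK_pos : ∀ x, 1 < ‖x‖ → 0 < K x)
    (hK : ∃ C > (0 : ℝ), ∃ γ > (N : ℝ), ∀ x, 1 < ‖x‖ → K x ≤ C / ‖x‖ ^ γ)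
    {r : ℝ≥0∞} [Fact (1 ≤ r)] (hr : r ≠ ∞)
    (ι : BeppoLevi N →L[ℝ] Lp ℝ r (weightedMeasure N K))
    (hι : ∀ φ : ExteriorTest N, ι (φ : BeppoLevi N) = (memLp_weightedMeasure hK hr φ).toLp φ) :
    Function.Injective ι := by
  have := isFiniteMeasure_weightedMeasure hK
  obtain ⟨G, hG, hGn⟩ := exists_beppoLeviGradient (N := N)
  obtain ⟨p, hp⟩ := exists_holderConjugate_dim (N := N)
  have hp' : ENNReal.HolderConjugate (N : ℝ≥0∞) (p : ℝ≥0∞) := by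
    simpa using hp.coe_ennreal
  have hp1 : Fact (1 ≤ (p : ℝ≥0∞)) := ⟨by exact_mod_cast hp.symm.lt.le⟩
  refine (injective_iff_map_eq_zero ι).2 fun u hu => ?_
  suffices hGu : G u = 0 by rw [← norm_eq_zero, ← hGn, hGu, norm_zero]
  have hr1 : 1 ≤ r := Fact.out
  -- The constant of the inclusion of L^r(K) into L¹(K).
  set B : ℝ≥0∞ := weightedMeasure N K Set.univ ^ (1 / (1 : ℝ≥0∞).toReal - 1 / r.toReal)
  have hB : B ≠ ∞ := by
    refine ENNReal.rpow_ne_top_of_nonneg ?_ (measure_ne_top _ _)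
    rw [sub_nonneg]
    exact one_div_le_one_div_of_le (by simp) (ENNReal.toReal_mono hr hr1)
  have hweak : ∀ g : EuclideanSpace ℝ (Fin N) → ℝ, ContDiff ℝ ((⊤ : ℕ∞) : WithTop ℕ∞) g →
      HasCompactSupport g → tsupport g ⊆ ↑(unitBallExterior N) →
      ∫ x, g x • G u x ∂volume.restrict ↑(unitBallExterior N) = 0 := by
    intro g hg hgc hgs
    have hgLp : MemLp g p (volume.restrict ↑(unitBallExterior N)) :=
      (hg.continuous.memLp_of_hasCompactSupport hgc).restrict _
    let A := (ContinuousLinearMap.lsmul ℝ ℝ (E := EuclideanSpace ℝ (Fin N))).flip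
    let F : BeppoLevi N →L[ℝ] EuclideanSpace ℝ (Fin N) :=
      ((A.lpPairing (volume.restrict ↑(unitBallExterior N)) N p).flip (hgLp.toLp g)).comp G
    have hF : ∀ w, F w = ∫ x, g x • G w x ∂volume.restrict ↑(unitBallExterior N) := by
      intro w
      change A.lpPairing (volume.restrict ↑(unitBallExterior N)) N p (G w) (hgLp.toLp g) = _
      rw [ContinuousLinearMap.lpPairing_eq_integral]
      refine integral_congr_ae ?_
      filter_upwards [hgLp.coeFn_toLp] with x hx
      rw [hx]
      rfl
    obtain ⟨M, hM⟩ := exists_norm_fderiv_le_mul hK_cont hK_pos hg hgc hgs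
    -- Both sides are continuous in w, so integration by parts on test functions suffices; at w = u
    -- the right side vanishes.
    have hbound : ∀ (v : EuclideanSpace ℝ (Fin N)) (w : BeppoLevi N),
        ‖inner ℝ v (F w)‖ₑ ≤ M * ‖v‖ₑ * (‖ι w‖ₑ * B) := by
      intro v w
      induction w using UniformSpace.Completion.induction_on with
      | hp =>
        refine isClosed_le (by fun_prop) ?_
        refine ENNReal.continuous_const_mul
          (ENNReal.mul_ne_top (by simp) enorm_ne_top) |>.comp ?_
        exact (ENNReal.continuous_mul_const hB).comp (by fun_prop)
      | ih φ =>
        have h1 : F (φ : BeppoLevi N) = ∫ x in ↑(unitBallExterior N), g x • ∇ φ x := by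
          rw [hF, hG]
          refine integral_congr_ae ?_
          filter_upwards [(φ.memLp_grad N).coeFn_toLp] with x hx
          rw [hx]
        rw [h1, inner_setIntegral_smul_grad hg hgc, enorm_neg]
        refine (enorm_integral_le_lintegral_enorm _).trans
          ((lintegral_enorm_fderiv_mul_le hK_cont hM v φ).trans ?_)
        refine mul_le_mul_right ?_ _
        rw [hι, Lp.enorm_toLp, ← eLpNorm_one_eq_lintegral_enorm]
        exact eLpNorm_le_eLpNorm_mul_rpow_measure_univ hr1
          φ.contDiff.continuous.aestronglyMeasurable
    rw [← hF]
    refine ext_inner_left ℝ fun v => ?_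
    have h2 := hbound v u
    rw [hu, enorm_zero, zero_mul, mul_zero] at h2
    rw [inner_zero_right, ← enorm_eq_zero]
    exact le_antisymm h2 zero_le
  -- The fundamental lemma of the calculus of variations; Gu is locally integrable because it lies
  -- in L^N.
  have hae := (unitBallExterior N).isOpen.ae_eq_zero_of_integral_contDiff_smul_eq_zero
    (((Lp.memLp (G u)).locallyIntegrable Fact.out).locallyIntegrableOn _) hweak
  rw [Lp.eq_zero_iff_ae_eq_zero]
  filter_upwards [hae, ae_restrict_mem ExteriorTest.measurableSet_exterior] with x h1 h2
  exact h1 h2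

end Injectivity

theorem theorem1p2 (N : ℕ) [Fact (2 ≤ N)]
    (K : EuclideanSpace ℝ (Fin N) → ℝ)
    (hK_cont : ContinuousOn K {x | 1 < ‖x‖})
    (hK_pos : ∀ x, 1 < ‖x‖ → 0 < K x)
    (hK_decay : ∃ C > (0 : ℝ), ∃ γ > (N : ℝ), ∀ x, 1 < ‖x‖ → K x ≤ C / ‖x‖ ^ γ)
    (r : ℝ≥0∞) [Fact (1 ≤ r)] (hr : r ≠ ∞) :
    ∃ ι : BeppoLevi N →L[ℝ] Lp ℝ r (weightedMeasure N K),
      (∀ φ : ExteriorTest N,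
        (ι (φ : BeppoLevi N) : EuclideanSpace ℝ (Fin N) → ℝ) =ᵐ[weightedMeasure N K] φ) ∧
      Function.Injective ι ∧
      IsCompactOperator ι := by
  obtain ⟨T, hT⟩ := exists_testInclusion hK_decay hr
  let ι := T.extend (UniformSpace.Completion.toComplL (𝕜 := ℝ) (E := ExteriorTest N))
  have hι : ∀ φ : ExteriorTest N,
      ι (φ : BeppoLevi N) = (memLp_weightedMeasure hK_decay hr φ).toLp φ := fun φ =>
    (T.extend_eq (e := UniformSpace.Completion.toComplL)
      UniformSpace.Completion.denseRange_coe
      (UniformSpace.Completion.isUniformInducing_coe _) φ).trans (hT φ)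
  refine ⟨ι, fun φ => ?_, injective_of_testInclusion hK_cont hK_pos hK_decay hr ι hι,
    isCompactOperator_of_testInclusion hK_decay hr ι hι⟩
  rw [hι]
  exact MemLp.coeFn_toLp _
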